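/- **Theorem (Asymptotic distribution for the Adaptive Transfer Lasso).** Setting. Let $y = X\beta^* + \varepsilon$ with a deterministic design $X = X_n \in \mathbb{R}^{n\times p}$ ($p$ fixed, rows $x_1,\dots,x_n$), $\beta^*\in\mathbb{R}^p$, and $\varepsilon_1,\dots,\varepsilon_n$ i.i.d. $\mathcal N(0,\sigma^2)$. Assume $\frac1n X^\top X \to C \succ O$ and $\frac1n\max_i\|x_i\|_2^2\to 0$ as $n\to\infty$. Put $S=\{j:\beta^*_j\ne 0\}$ and $S^c=\{j:\beta^*_j=0\}$. Let $m=m_n$ be positive integers with $n/m\to r_0\ge 0$, and let $\tilde\beta=\tilde\beta_n$ be a random vector, independent of $\varepsilon$, such that $\sqrt m(\tilde\beta-\beta^*)$ converges in distribution to a random vector $z$. Let $W\sim\mathcal N(0,\sigma^2C)$ be independent of $z$. For $\gamma_1,\gamma_2\ge 0$ and $\lambda_n,\eta_n\ge 0$ let $$\hat\beta_n \in \operatorname*{argmin}_{\beta\in\mathbb{R}^p}\Big\{\tfrac1n\|y-X\beta\|_2^2+\tfrac{\lambda_n}{n}\sum_j\frac{|\beta_j|}{|\tilde\beta_j|^{\gamma_1}}+\tfrac{\eta_n}{n}\sum_j|\tilde\beta_j|^{\gamma_2}|\beta_j-\tilde\beta_j|\Big\}$$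 be a measurable choice of minimizer, with the conventions $1/0=\infty$, $\infty\cdot 0=0$ and $0^0=1$. Consider the condition (N) $P(z_j=0)=0$ for every $j\in S^c$. Then the following hold as $n\to\infty$; in (iii)–(vi) the minimizers on the right-hand sides exist and are unique (almost surely). (i) If $\eta_n/\sqrt{nm^{\gamma_2}}\to\infty$ and $\sqrt{m^{\gamma_1+\gamma_2}}\,\lambda_n/\eta_n\to 0$, and if (N) holds or $\gamma_2=0$, then $\sqrt m(\hat\beta_n-\beta^*)\overset{d}{\to}z$. (ii) If $\sqrt{m^{\gamma_1}/n}\,\lambda_n\to\infty$, $\eta_n/\sqrt n\to\infty$, $\eta_n/\lambda_n\to\infty$, $\eta_n/(\sqrt{m^{\gamma_1+\gamma_2}}\,\lambda_n)\to0$ and $\sqrt{m^{\gamma_1}}\lambda_n/\eta_n\to\rho_0\in[0,\infty]$, then $\sqrt m(\hat\beta_n-\beta^*)\overset{d}{\to}\bar z$, where $\bar z_j=z_j$ for $j\in S$ and $\bar z_j=0$ for $j\in S^c$. (iii) If $\sqrt{m^{\gamma_1}/n}\,\lambda_n\to\lambda_1\ge0$ and $\eta_n/\sqrt n\to\eta_0\ge0$,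 where $\lambda_1=0$ in case $\gamma_1=0$ and $\eta_0=0$ in case $\gamma_2=0$, and if (N) holds or $\gamma_1=0$, then $$\sqrt n(\hat\beta_n-\beta^*)\overset{d}{\to}\operatorname*{argmin}_{u}\Big\{u^\top Cu-2u^\top W+\sum_{j\in S^c}\frac{\lambda_1}{|z_j|^{\gamma_1}}|u_j|+\sum_{j\in S}\eta_0|\beta^*_j|^{\gamma_2}|u_j-\sqrt{r_0}z_j|\Big\}.$$ (iv) If $\sqrt{m^{\gamma_1}/n}\,\lambda_n\to\lambda_1\ge0$, $\eta_n/\sqrt n\to\infty$ and $\eta_n/\sqrt{nm^{\gamma_2}}\to\eta_1\ge0$, and if (N) holds or $\gamma_1=0$, then $$\sqrt n(\hat\beta_n-\beta^*)\overset{d}{\to}\operatorname*{argmin}_{u:\,u_S=\sqrt{r_0}z_S}\Big\{u^\top Cu-2u^\top W+\sum_{j\in S^c}\Big(\frac{\lambda_1}{|z_j|^{\gamma_1}}|u_j|+\eta_1|z_j|^{\gamma_2}|u_j-\sqrt{r_0}z_j|\Big)\Big\}.$$ (v) If $\sqrt{m^{\gamma_1}/n}\,\lambda_n\to\infty$, $\lambda_n/\sqrt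 n\to\lambda_0\ge0$ and $\eta_n/\sqrt n\to\eta_0\ge0$, then $$\sqrt n(\hat\beta_n-\beta^*)\overset{d}{\to}\operatorname*{argmin}_{u:\,u_{S^c}=0}\Big\{u^\top Cu-2u^\top W+\sum_{j\in S}\Big(\lambda_0\frac{\operatorname{sgn}(\beta^*_j)}{|\beta^*_j|^{\gamma_1}}u_j+\eta_0|\beta^*_j|^{\gamma_2}|u_j-\sqrt{r_0}z_j|\Big)\Big\}.$$ (vi) If $\gamma_1>0$, $\lambda_n/\sqrt n\to\infty$, $\lambda_n/n\to0$ and $\eta_n/\lambda_n\to0$, then $$\frac{n}{\lambda_n}(\hat\beta_n-\beta^*)\overset{d}{\to}\operatorname*{argmin}_{u:\,u_{S^c}=0}\Big\{u^\top Cu+\sum_{j\in S}\frac{\operatorname{sgn}(\beta^*_j)}{|\beta^*_j|^{\gamma_1}}u_j\Big\}.$$ -/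

import Mathlib

open MeasureTheory ProbabilityTheory Filter Topology
open scoped ENNReal NNReal Matrix

namespace AdaptiveTransferLasso

/-- Vectors of regression coefficients, with the Euclidean norm. -/
abbrev Coef (p : ℕ) : Type := EuclideanSpace ℝ (Fin p)

/-- The response vector `y = X β + ε` of a linear model. -/
noncomputable def response {n p : ℕ} (X : Matrix (Fin n) (Fin p) ℝ) (β : Coef p)
    (ε : Fin n → ℝ) : Fin n → ℝ :=
  X *ᵥ β.ofLp + ε

/-- The adaptive transfer lasso objective
`(1/n) ‖y - X β‖² + (lam/n) ∑ⱼ vⱼ |βⱼ| + (eta/n) ∑ⱼ wⱼ |βⱼ - βtⱼ|`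
with `vⱼ = 1 / |βtⱼ| ^ γ₁` and `wⱼ = |βtⱼ| ^ γ₂`.  It takes values in `[0, ∞]`: if `βtⱼ = 0` and
`γ₁ > 0`, then `vⱼ = ∞`, so that (for `lam > 0`) the `j`-th coefficient is forced to vanish; here
`∞ * 0 = 0`, and `0 ^ 0 = 1`. -/
noncomputable def objective {n p : ℕ} (X : Matrix (Fin n) (Fin p) ℝ) (y : Fin n → ℝ)
    (βt : Coef p) (lam eta γ₁ γ₂ : ℝ) (β : Coef p) : ℝ≥0∞ :=
  ENNReal.ofReal (1 / n * ‖WithLp.toLp 2 (y - X *ᵥ β.ofLp)‖ ^ 2)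
    + ENNReal.ofReal (lam / n) *
        ∑ j, (ENNReal.ofReal (|βt j| ^ γ₁))⁻¹ * ENNReal.ofReal |β j|
    + ENNReal.ofReal (eta / n) *
        ∑ j, ENNReal.ofReal (|βt j| ^ γ₂) * ENNReal.ofReal |β j - βt j|

/-- `β` minimizes the adaptive transfer lasso objective over all coefficient vectors. -/
def IsEstimate {n p : ℕ} (X : Matrix (Fin n) (Fin p) ℝ) (y : Fin n → ℝ)
    (βt : Coef p) (lam eta γ₁ γ₂ : ℝ) (β : Coef p) : Prop :=
  ∀ b : Coef p, objective X y βt lam eta γ₁ γ₂ β ≤ objective X y βt lam eta γ₁ γ₂ b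

/-- The active set `S` of a coefficient vector. -/
noncomputable def active {p : ℕ} (β : Coef p) : Finset (Fin p) :=
  {j | β j ≠ 0}

/-- The quadratic form `uᵀ C u`. -/
noncomputable def quad {p : ℕ} (C : Matrix (Fin p) (Fin p) ℝ) (u : Coef p) : ℝ :=
  u.ofLp ⬝ᵥ (C *ᵥ u.ofLp)

/-- `u` is the unique minimizer of `f` over `U`, that is, `u = argmin_{v ∈ U} f v`. -/
def IsArgmin {p : ℕ} (U : Set (Coef p)) (f : Coef p → ℝ) (u : Coef p) : Prop :=
  u ∈ U ∧ ∀ v ∈ U, v ≠ u → f u < f v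

end AdaptiveTransferLasso

open AdaptiveTransferLasso

/-! Fix a scale `s` and write `u = s (β - β*)`. Up to a term free of `β`, `s ^ 2` times the
objective is a quadratic form in `u` with matrix `Xᵀ X / n`, minus twice the inner product of `u`
with `s / √n` times the score `Xᵀ ε / √n`, plus one penalty per coordinate: an adaptive one with
kink at `β_j = 0` and a transfer one with kink at `u_j = s (β̃_j - β*_j)`. The initial estimate
tends to `β*_j ≠ 0` at an active coordinate, but is of order `z_j / √m` at an inactive one. Hence
`λ` acts there with an extra factor `√(m ^ γ₁)` and `η` with an extra factor `1 / √(m ^ γ₂)`, which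
produces all the rates.

A penalty whose weight converges survives in the limit. If one weight exceeds the other by an amount
tending to infinity, it pins its coordinate at its kink: `0` for the adaptive penalty at an inactive
coordinate, the initial estimate for the transfer penalty. The limit objective is strictly convex on
the remaining coordinates, so compactness and uniqueness of its minimizer give convergence of the
estimates (`tendsto_of_forall_objective_le`, `tendsto_smul_sub`). This covers (iii)–(v) with `s =
√n` and (vi) with `s = n / λ`. In (i) and (ii) every coordinate is pinned at the scale `√m`; there
`s / √n` may be unbounded, and `tendsto_sqrt_source_smul_sub` compares the penalties directly with
the quadratic and noise terms.

An adaptive weight may be infinite. The estimate is compared only with competitors chosen in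
advance, so at a coordinate where the competitor vanishes any finite lower bound of the weight can
replace it (`IsEstimate.rescaled_le`).

All this is deterministic, along sequences on which the scaled initial estimates and the scores
converge. By independence the pair converges jointly in distribution to `(z, W)`, and an extended
continuous mapping theorem (`tendstoInDistribution_of_forall_seq`) transfers the deterministic
limits to laws. It asks for no measurable dependence of the estimate on the data pair. The limiting
minimizer is a measurable function of `(z, W)` because it depends continuously on the parameters of
the limit objective. -/

namespace AdaptiveTransferLasso

/-! ### Convergence in distribution through deterministic sequences -/

section ConvergenceInDistribution

variable {Ω Ω' : Type*} [MeasurableSpace Ω] [MeasurableSpace Ω']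
  {P : Measure Ω} [IsProbabilityMeasure P] {P' : Measure Ω'} [IsProbabilityMeasure P']

/-- An extended continuous mapping theorem.  If `X n` converges in distribution to `Z`, if `Y n` is
related to `X n` by `R n`, and if, for almost every `ω`, the relations `R n` force convergence to
`G ω` along all sequences that converge to `Z ω`, then `Y n` converges in distribution to `G`. -/
theorem tendstoInDistribution_of_forall_seq {E F : Type*}
    [PseudoMetricSpace E] [MeasurableSpace E] [BorelSpace E]
    [PseudoMetricSpace F] [MeasurableSpace F] [BorelSpace F]
    {X : ℕ → Ω → E} {Y : ℕ → Ω → F} {Z : Ω' → E} {G : Ω' → F} (R : ℕ → E → F → Prop)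
    (hX : TendstoInDistribution X atTop Z (fun _ => P) P')
    (hY : ∀ n, AEMeasurable (Y n) P) (hG : AEMeasurable G P')
    (hR : ∀ n, ∀ᵐ ω ∂P, R n (X n ω) (Y n ω))
    (h : ∀ᵐ ω ∂P', ∀ (k : ℕ → ℕ) (x : ℕ → E) (y : ℕ → F), Tendsto k atTop atTop →
      Tendsto x atTop (𝓝 (Z ω)) → (∀ i, R (k i) (x i) (y i)) → Tendsto y atTop (𝓝 (G ω))) :
    TendstoInDistribution Y atTop G (fun _ => P) P' := by
  refine ⟨hY, hG, tendsto_of_forall_isClosed_limsup_le' fun K hK => ?_⟩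
  -- By the portmanteau theorem it suffices to bound the limsup of `P (Y n ∈ K)` for closed `K`. The
  -- event `Y n ∈ K` forces `X n` into `D N` once `n ≥ N`. Passing to closures makes the sets
  -- measurable, whatever `R` is.
  let D : ℕ → Set E := fun N => {x | ∃ k ≥ N, ∃ y ∈ K, R k x y}
  have hanti : Antitone fun N => closure (D N) := fun a b hab =>
    closure_mono fun x ⟨k, hk, hy⟩ => ⟨k, hab.trans hk, hy⟩
  have hstep : ∀ N, limsup (fun n => P.map (Y n) K) atTop ≤ P'.map Z (closure (D N)) := by
    intro N
    refine le_trans ?_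
      (ProbabilityMeasure.limsup_measure_closed_le_of_tendsto hX.tendsto isClosed_closure)
    refine limsup_le_limsup ?_
    filter_upwards [eventually_ge_atTop N] with n hn
    simp only [ProbabilityMeasure.coe_mk]
    rw [Measure.map_apply_of_aemeasurable (hY n) hK.measurableSet,
      Measure.map_apply_of_aemeasurable (hX.forall_aemeasurable n) isClosed_closure.measurableSet]
    refine measure_mono_ae ?_
    filter_upwards [hR n] with ω hω hωK
    exact subset_closure ⟨n, hn, Y n ω, hωK, hω⟩
  have hlim : Tendsto (fun N => P'.map Z (closure (D N))) atTop
      (𝓝 (P'.map Z (⋂ N, closure (D N)))) := by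
    have := Measure.isProbabilityMeasure_map (μ := P') hX.aemeasurable_limit
    exact tendsto_measure_iInter_atTop
      (fun N => isClosed_closure.measurableSet.nullMeasurableSet) hanti ⟨0, measure_ne_top _ _⟩
  refine (ge_of_tendsto' hlim hstep).trans ?_
  simp only [ProbabilityMeasure.coe_mk]
  rw [Measure.map_apply_of_aemeasurable hG hK.measurableSet,
      Measure.map_apply_of_aemeasurable hX.aemeasurable_limit
        (MeasurableSet.iInter fun N => isClosed_closure.measurableSet)]
  refine measure_mono_ae ?_
  filter_upwards [h] with ω hω hmem
  -- A point in every `closure (D i)` is a limit of points `x i ∈ D i`. The witnesses `y i ∈ K` then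
  -- converge to `G ω`, which lies in `K` because `K` is closed.
  have hmem' : ∀ i : ℕ, ∃ x : E, dist (Z ω) x < 1 / ((i : ℝ) + 1) ∧ ∃ k ≥ i, ∃ y ∈ K, R k x y := by
    intro i
    have hi : Z ω ∈ closure (D i) := Set.mem_iInter.1 hmem i
    obtain ⟨x, hx, hxd⟩ := Metric.mem_closure_iff.1 hi _ (Nat.one_div_pos_of_nat (α := ℝ) (n := i))
    exact ⟨x, hxd, hx⟩
  choose x hx k hk y hyK hyR using hmem'
  have hxlim : Tendsto x atTop (𝓝 (Z ω)) := by
    rw [tendsto_iff_dist_tendsto_zero]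
    refine squeeze_zero (fun _ => dist_nonneg) (fun i => ?_)
      (tendsto_one_div_add_atTop_nhds_zero_nat (𝕜 := ℝ))
    rw [dist_comm]; exact (hx i).le
  exact hK.mem_of_tendsto (hω k x y (tendsto_atTop_mono hk tendsto_id) hxlim hyR)
    (Eventually.of_forall hyK)

/-- Convergence in distribution of independent pairs. -/
theorem tendstoInDistribution_prodMk_of_indepFun {E F : Type*}
    [PseudoMetricSpace E] [SecondCountableTopology E] [MeasurableSpace E] [BorelSpace E]
    [PseudoMetricSpace F] [SecondCountableTopology F] [MeasurableSpace F] [BorelSpace F]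
    {X : ℕ → Ω → E} {Y : ℕ → Ω → F} {Z : Ω' → E} {W : Ω' → F}
    (hX : TendstoInDistribution X atTop Z (fun _ => P) P')
    (hY : TendstoInDistribution Y atTop W (fun _ => P) P')
    (hXY : ∀ n, IndepFun (X n) (Y n) P) (hZW : IndepFun Z W P') :
    TendstoInDistribution (fun n ω => (X n ω, Y n ω)) atTop (fun ω => (Z ω, W ω))
      (fun _ => P) P' := by
  have hXm := hX.forall_aemeasurable
  have hYm := hY.forall_aemeasurable
  have hZm := hX.aemeasurable_limit
  have hWm := hY.aemeasurable_limit
  refine ⟨fun n => (hXm n).prodMk (hYm n), hZm.prodMk hWm, ?_⟩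
  have hlim := (ProbabilityMeasure.continuous_prod (α := E) (β := F)).continuousAt.tendsto.comp
    (hX.tendsto.prodMk_nhds hY.tendsto)
  convert! hlim using 2
  · congr 1
    ext1 n
    refine Subtype.ext ?_
    exact (indepFun_iff_map_prod_eq_prod_map_map (hXm n) (hYm n)).1 (hXY n)
  · congr 1
    refine Subtype.ext ?_
    exact (indepFun_iff_map_prod_eq_prod_map_map hZm hWm).1 hZW

end ConvergenceInDistribution

/-! ### Asymptotic normality of the score -/

/-- The score vector `(1/√n) Xᵀ ε`. -/
noncomputable def score {n p : ℕ} (X : Matrix (Fin n) (Fin p) ℝ) (e : Fin n → ℝ) : Coef p :=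
  (1 / √(n : ℝ)) • WithLp.toLp 2 (Xᵀ *ᵥ e)

theorem measurable_score {n p : ℕ} (X : Matrix (Fin n) (Fin p) ℝ) : Measurable (score X) := by
  have : Continuous (score X) := by
    unfold score
    fun_prop
  exact this.measurable

theorem inner_score {n p : ℕ} (X : Matrix (Fin n) (Fin p) ℝ) (e : Fin n → ℝ) (t : Coef p) :
    inner ℝ (score X e) t =
      inner ℝ (WithLp.toLp 2 e) (WithLp.toLp 2 ((1 / √(n : ℝ)) • (X *ᵥ t.ofLp))) := by
  simp only [score, EuclideanSpace.inner_eq_star_dotProduct, WithLp.ofLp_smul, star_trivial]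
  rw [dotProduct_smul, smul_dotProduct, Matrix.mulVec_transpose, dotProduct_comm t.ofLp,
    ← Matrix.dotProduct_mulVec, dotProduct_comm e]

/-- The pairing of the score with `t` is the pairing of the noise with `X t / √n`. Independence
factors the characteristic function, and the variances add up to `σ ^ 2` times the Gram form at `t`.
-/
theorem charFun_map_score {Ω : Type*} [MeasurableSpace Ω] {P : Measure Ω} [IsProbabilityMeasure P]
    {n p : ℕ} (X : Matrix (Fin n) (Fin p) ℝ) (σ : ℝ≥0) (ε : Fin n → Ω → ℝ)
    (hε : ∀ i, HasLaw (ε i) (gaussianReal 0 (σ ^ 2)) P) (hind : iIndepFun ε P) (t : Coef p) :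
    charFun (P.map fun ω => score X fun i => ε i ω) t =
      Complex.exp (-(((σ : ℝ) ^ 2 * quad ((1 / n : ℝ) • (Xᵀ * X)) t : ℝ) : ℂ) / 2) := by
  have hm : ∀ i, AEMeasurable (ε i) P := fun i => (hε i).aemeasurable
  have hvec : AEMeasurable (fun ω i => ε i ω) P := aemeasurable_pi_lambda _ hm
  have h1 : charFun (P.map fun ω => score X fun i => ε i ω) t =
      charFun (P.map fun ω => WithLp.toLp 2 fun i => ε i ω)
        (WithLp.toLp 2 ((1 / √(n : ℝ)) • (X *ᵥ t.ofLp))) := by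
    rw [charFun_apply, charFun_apply, integral_map, integral_map]
    · simp_rw [inner_score]
    · exact (WithLp.measurable_toLp 2 _).comp_aemeasurable hvec
    · exact Measurable.aestronglyMeasurable (by fun_prop)
    · exact (measurable_score X).comp_aemeasurable hvec
    · exact Measurable.aestronglyMeasurable (by fun_prop)
  rw [h1, (iIndepFun_iff_charFun_pi hm).1 hind]
  simp_rw [(hε _).map_eq, charFun_gaussianReal, ← Complex.exp_sum]
  congr 1
  have hq : quad ((1 / n : ℝ) • (Xᵀ * X)) t = ∑ i, (1 / √(n : ℝ) * (X *ᵥ t.ofLp) i) ^ 2 := by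
    have : (√(n : ℝ))⁻¹ ^ 2 = (n : ℝ)⁻¹ := by
      rw [inv_pow, Real.sq_sqrt (Nat.cast_nonneg n)]
    rw [quad, Matrix.smul_mulVec, dotProduct_smul, ← Matrix.mulVec_mulVec,
      Matrix.dotProduct_mulVec, Matrix.vecMul_transpose, dotProduct, smul_eq_mul, Finset.mul_sum]
    refine Finset.sum_congr rfl fun i _ => ?_
    rw [mul_pow, one_div, one_div, this]; ring
  rw [hq]
  push_cast
  simp only [Pi.smul_apply, smul_eq_mul]
  rw [Finset.mul_sum, ← Finset.sum_neg_distrib, Finset.sum_div]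
  refine Finset.sum_congr rfl fun i _ => ?_
  push_cast
  ring

theorem continuous_quad_left {p : ℕ} (u : Coef p) :
    Continuous fun C : Matrix (Fin p) (Fin p) ℝ => quad C u := by
  unfold quad
  fun_prop

/-- The score vectors of designs with `(1/n) Xᵀ X → C` are asymptotically Gaussian. -/
theorem tendstoInDistribution_score {Ω Ω' : Type*} [MeasurableSpace Ω] [MeasurableSpace Ω']
    {P : Measure Ω} [IsProbabilityMeasure P] {P' : Measure Ω'} [IsProbabilityMeasure P']
    {p : ℕ} {X : (n : ℕ) → Matrix (Fin n) (Fin p) ℝ} {C : Matrix (Fin p) (Fin p) ℝ} (hC : C.PosDef)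
    (hXC : Tendsto (fun n : ℕ => (1 / n : ℝ) • ((X n)ᵀ * X n)) atTop (𝓝 C)) {σ : ℝ≥0}
    {ε : (n : ℕ) → Fin n → Ω → ℝ} (hε : ∀ n i, HasLaw (ε n i) (gaussianReal 0 (σ ^ 2)) P)
    (hεindep : ∀ n, iIndepFun (ε n) P) {W : Ω' → Coef p}
    (hW : HasLaw W (multivariateGaussian 0 ((σ : ℝ) ^ 2 • C)) P') :
    TendstoInDistribution (fun n ω => score (X n) fun i => ε n i ω) atTop W (fun _ => P) P' := by
  refine ⟨fun n => (measurable_score _).comp_aemeasurable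
    (aemeasurable_pi_lambda _ fun i => (hε n i).aemeasurable), hW.aemeasurable, ?_⟩
  -- The score is exactly Gaussian for every `n`, so Lévy's continuity theorem only needs the
  -- covariances to converge.
  refine ProbabilityMeasure.tendsto_of_tendsto_charFun fun t => ?_
  simp only [ProbabilityMeasure.coe_mk]
  have hpsd : ((σ : ℝ) ^ 2 • C).PosSemidef := hC.posSemidef.smul (sq_nonneg _)
  rw [hW.map_eq, charFun_multivariateGaussian hpsd]
  simp_rw [charFun_map_score _ σ _ (hε _) (hεindep _)]
  have hlim : Tendsto (fun n : ℕ => (σ : ℝ) ^ 2 * quad ((1 / n : ℝ) • ((X n)ᵀ * X n)) t) atTop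
      (𝓝 ((σ : ℝ) ^ 2 * quad C t)) :=
    (((continuous_quad_left t).tendsto C).comp hXC).const_mul _
  have hexp : Continuous fun x : ℝ => Complex.exp (-(x : ℂ) / 2) := by fun_prop
  convert (hexp.tendsto _).comp hlim using 3
  · rfl
  rw [inner_zero_right]
  simp only [ quad, Matrix.smul_mulVec, dotProduct_smul, smul_eq_mul]
  push_cast
  ring

/-! ### Quadratic forms -/

section Quadratic

variable {p : ℕ}

theorem dotProduct_eq_inner (u w : Coef p) : u.ofLp ⬝ᵥ w.ofLp = inner ℝ u w := by
  rw [EuclideanSpace.inner_eq_star_dotProduct, star_trivial, dotProduct_comm]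

theorem abs_dotProduct_le (u w : Coef p) : |u.ofLp ⬝ᵥ w.ofLp| ≤ ‖u‖ * ‖w‖ := by
  rw [dotProduct_eq_inner]; exact abs_real_inner_le_norm u w

theorem abs_apply_le_norm (u : Coef p) (j : Fin p) : |u j| ≤ ‖u‖ := by
  simpa using PiLp.norm_apply_le u j

theorem quad_eq_sum (C : Matrix (Fin p) (Fin p) ℝ) (u : Coef p) :
    quad C u = ∑ i, ∑ j, u i * (C i j * u j) := by
  simp only [quad, dotProduct, Matrix.mulVec, Finset.mul_sum]

theorem abs_quad_le (C : Matrix (Fin p) (Fin p) ℝ) (u : Coef p) :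
    |quad C u| ≤ (∑ i, ∑ j, |C i j|) * ‖u‖ ^ 2 := by
  rw [quad_eq_sum, Finset.sum_mul]
  refine (Finset.abs_sum_le_sum_abs _ _).trans (Finset.sum_le_sum fun i _ => ?_)
  rw [Finset.sum_mul]
  refine (Finset.abs_sum_le_sum_abs _ _).trans (Finset.sum_le_sum fun j _ => ?_)
  rw [abs_mul, abs_mul]
  calc |u i| * (|C i j| * |u j|) = |C i j| * (|u i| * |u j|) := by ring
    _ ≤ |C i j| * (‖u‖ * ‖u‖) := by gcongr <;> exact abs_apply_le_norm u _
    _ = |C i j| * ‖u‖ ^ 2 := by ring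

theorem quad_sub_left (C D : Matrix (Fin p) (Fin p) ℝ) (u : Coef p) :
    quad (C - D) u = quad C u - quad D u := by
  simp only [quad, Matrix.sub_mulVec, dotProduct_sub]

theorem continuous_quad :
    Continuous fun q : Matrix (Fin p) (Fin p) ℝ × Coef p => quad q.1 q.2 := by
  simp only [quad_eq_sum]
  fun_prop

theorem quad_smul (C : Matrix (Fin p) (Fin p) ℝ) (a : ℝ) (u : Coef p) :
    quad C (a • u) = a ^ 2 * quad C u := by
  simp only [quad_eq_sum, PiLp.smul_apply, smul_eq_mul, Finset.mul_sum]
  refine Finset.sum_congr rfl fun i _ => Finset.sum_congr rfl fun j _ => ?_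
  ring

theorem quad_parallelogram (C : Matrix (Fin p) (Fin p) ℝ) (u v : Coef p) :
    quad C (u + v) + quad C (u - v) = 2 * quad C u + 2 * quad C v := by
  simp only [quad_eq_sum, PiLp.add_apply, PiLp.sub_apply, Finset.mul_sum,
    ← Finset.sum_add_distrib]
  refine Finset.sum_congr rfl fun i _ => Finset.sum_congr rfl fun j _ => ?_
  ring

theorem quad_pos {C : Matrix (Fin p) (Fin p) ℝ} (hC : C.PosDef) {u : Coef p} (hu : u ≠ 0) :
    0 < quad C u := by
  have h : u.ofLp ≠ 0 := by simpa using hu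
  simpa [quad] using hC.dotProduct_mulVec_pos h

/-- The constant is the minimum of the form on the compact unit sphere, extended by homogeneity. An
empty sphere means that the zero vector is the only one. -/
theorem exists_mul_sq_norm_le_quad {C : Matrix (Fin p) (Fin p) ℝ} (hC : C.PosDef) :
    ∃ κ > 0, ∀ u : Coef p, κ * ‖u‖ ^ 2 ≤ quad C u := by
  by_cases hne : (Metric.sphere (0 : Coef p) 1).Nonempty
  · obtain ⟨v, hv, hmin⟩ := (isCompact_sphere (0 : Coef p) 1).exists_isMinOn hne
      (f := quad C) (by
        have : Continuous (quad C) := continuous_quad.comp (Continuous.prodMk_right C)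
        exact this.continuousOn)
    have hv0 : v ≠ 0 := by
      rintro rfl
      simp at hv
    refine ⟨quad C v, quad_pos hC hv0, fun u => ?_⟩
    rcases eq_or_ne u 0 with rfl | hu
    · simp [quad]
    have hn : ‖u‖ ≠ 0 := norm_ne_zero_iff.2 hu
    have hmem : ‖u‖⁻¹ • u ∈ Metric.sphere (0 : Coef p) 1 := by
      simp [norm_smul, hn]
    have h := hmin hmem
    simp only [Set.mem_ofPred_eq, quad_smul] at h
    calc quad C v * ‖u‖ ^ 2 ≤ (‖u‖⁻¹ ^ 2 * quad C u) * ‖u‖ ^ 2 := by gcongr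
      _ = quad C u := by field_simp
  · refine ⟨1, one_pos, fun u => ?_⟩
    rcases eq_or_ne u 0 with rfl | hu
    · simp [quad]
    have hn : ‖u‖ ≠ 0 := norm_ne_zero_iff.2 hu
    exact absurd ⟨‖u‖⁻¹ • u, by simp [norm_smul, hn]⟩ hne

/-- Half of the coercivity constant of the limit survives once the entrywise perturbation has total
size below the other half. -/
theorem exists_eventually_mul_sq_norm_le_quad {C : Matrix (Fin p) (Fin p) ℝ} (hC : C.PosDef)
    {Cs : ℕ → Matrix (Fin p) (Fin p) ℝ} (hCs : Tendsto Cs atTop (𝓝 C)) :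
    ∃ κ > 0, ∀ᶠ n in atTop, ∀ u : Coef p, κ * ‖u‖ ^ 2 ≤ quad (Cs n) u := by
  obtain ⟨κ, hκ, h⟩ := exists_mul_sq_norm_le_quad hC
  refine ⟨κ / 2, by positivity, ?_⟩
  have hcont : Continuous fun D : Matrix (Fin p) (Fin p) ℝ => ∑ i, ∑ j, |(D - C) i j| := by
    fun_prop
  have hlim : Tendsto (fun n => ∑ i, ∑ j, |(Cs n - C) i j|) atTop (𝓝 0) := by
    simpa [Function.comp_def] using (hcont.tendsto C).comp hCs
  filter_upwards [hlim.eventually_lt_const (half_pos hκ)] with n hn u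
  have h1 := abs_le.1 (abs_quad_le (Cs n - C) u)
  rw [quad_sub_left] at h1
  have h2 : (∑ i, ∑ j, |(Cs n - C) i j|) * ‖u‖ ^ 2 ≤ κ / 2 * ‖u‖ ^ 2 := by gcongr
  linarith [h u, h1.1]

end Quadratic

/-! ### Existence, uniqueness and convergence of minimizers -/

section Argmin

variable {p : ℕ}

/-- If `x > 1` and `κ x > a + b`, then `κ x ^ 2 > (a + b) x ≥ a x + b`. -/
theorem le_of_mul_sq_le {κ a b x : ℝ} (hκ : 0 < κ) (ha : 0 ≤ a) (hb : 0 ≤ b)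
    (h : κ * x ^ 2 ≤ a * x + b) : x ≤ (a + b) / κ + 1 := by
  by_contra! hlt
  have hq : 0 ≤ (a + b) / κ := by positivity
  have h1 : 1 < x := by linarith
  have h2 : a + b < κ * x := by
    have : (a + b) / κ < x := by linarith
    rw [div_lt_iff₀ hκ] at this
    linarith
  nlinarith

/-- Coercivity: a bound on the objective bounds the argument. -/
theorem norm_le_of_objective_le {C : Matrix (Fin p) (Fin p) ℝ} {w u : Coef p}
    {h : Fin p → ℝ → ℝ} {T : Finset (Fin p)} {κ L K D : ℝ} (hκ : 0 < κ) (hL0 : 0 ≤ L)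
    (hC : κ * ‖u‖ ^ 2 ≤ quad C u) (hL : ∀ j ∈ T, ∀ x, -(L * (1 + |x|)) ≤ h j x)
    (hw : ‖w‖ ≤ K) (hu : quad C u - 2 * (u.ofLp ⬝ᵥ w.ofLp) + ∑ j ∈ T, h j (u j) ≤ D) :
    ‖u‖ ≤ (2 * K + p * L + (|D| + p * L)) / κ + 1 := by
  have hK : 0 ≤ K := (norm_nonneg _).trans hw
  refine le_of_mul_sq_le hκ (by positivity) (by positivity) ?_
  have h1 : u.ofLp ⬝ᵥ w.ofLp ≤ ‖u‖ * K :=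
    (le_abs_self _).trans ((abs_dotProduct_le u w).trans (by gcongr))
  have h2 : -(p * (L * (1 + ‖u‖))) ≤ ∑ j ∈ T, h j (u j) := by
    calc -(p * (L * (1 + ‖u‖))) ≤ -(T.card * (L * (1 + ‖u‖))) := by
          have : (T.card : ℝ) ≤ p := by
            exact_mod_cast (Finset.card_le_univ T).trans_eq (Fintype.card_fin p)
          gcongr
      _ = ∑ j ∈ T, -(L * (1 + ‖u‖)) := by simp
      _ ≤ ∑ j ∈ T, h j (u j) := by
          refine Finset.sum_le_sum fun j hj => le_trans ?_ (hL j hj (u j))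
          have := abs_apply_le_norm u j
          gcongr
  have h3 := le_abs_self D
  nlinarith

/-- Existence and uniqueness of minimizers of a positive definite quadratic function plus a
separable convex penalty, with some coordinates held fixed. -/
theorem exists_isArgmin {C : Matrix (Fin p) (Fin p) ℝ} (hC : C.PosDef) (w : Coef p)
    (c : Fin p → ℝ) (T : Finset (Fin p)) {h : Fin p → ℝ → ℝ} (hcont : ∀ j, Continuous (h j))
    (hmid : ∀ j x y, h j ((x + y) / 2) ≤ (h j x + h j y) / 2)
    {L : ℝ} (hL0 : 0 ≤ L) (hL : ∀ j ∈ T, ∀ x, -(L * (1 + |x|)) ≤ h j x) :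
    ∃ u, IsArgmin {v | ∀ j ∉ T, v j = c j}
      (fun v => quad C v - 2 * (v.ofLp ⬝ᵥ w.ofLp) + ∑ j ∈ T, h j (v j)) u := by
  set f : Coef p → ℝ := fun v => quad C v - 2 * (v.ofLp ⬝ᵥ w.ofLp) + ∑ j ∈ T, h j (v j) with hf
  have hfc : Continuous f := by
    have h1 : Continuous (quad C) := continuous_quad.comp (Continuous.prodMk_right C)
    have h2 : Continuous fun v : Coef p => v.ofLp ⬝ᵥ w.ofLp := by fun_prop
    exact (h1.sub (h2.const_mul 2)).add
      (continuous_finsetSum _ fun j _ => (hcont j).comp (by fun_prop))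
  obtain ⟨κ, hκ, hκC⟩ := exists_mul_sq_norm_le_quad hC
  have hclosed : IsClosed {v : Coef p | ∀ j ∉ T, v j = c j} := by
    simp only [Set.ofPred_forall]
    exact isClosed_iInter fun j => isClosed_iInter fun _ =>
      isClosed_eq (by fun_prop) continuous_const
  let v₀ : Coef p := WithLp.toLp 2 c
  have hv₀ : v₀ ∈ {v : Coef p | ∀ j ∉ T, v j = c j} := fun j _ => rfl
  have hcoer : ∀ᶠ v in cocompact (Coef p) ⊓ 𝓟 {v : Coef p | ∀ j ∉ T, v j = c j},
      f v₀ ≤ f v := by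
    refine Filter.Eventually.filter_mono inf_le_left ?_
    filter_upwards [(tendsto_norm_cocompact_atTop (E := Coef p)).eventually_gt_atTop
      ((2 * ‖w‖ + p * L + (|f v₀| + p * L)) / κ + 1)] with v hv
    by_contra! hlt
    exact absurd (norm_le_of_objective_le hκ hL0 (hκC v) hL le_rfl hlt.le) (not_le.2 hv)
  obtain ⟨u, huU, hu⟩ := hfc.continuousOn.exists_isMinOn' hclosed hv₀ hcoer
  refine ⟨u, huU, fun v hvU hne => ?_⟩
  by_contra! hle
  -- Were `v` as good as `u`, their midpoint would be strictly better: the parallelogram identity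
  -- gains `quad C (u - v) / 4`, and the penalties are midpoint convex.
  have hmem : (1 / 2 : ℝ) • (u + v) ∈ {v : Coef p | ∀ j ∉ T, v j = c j} := by
    intro j hj
    simp only [PiLp.smul_apply, PiLp.add_apply, smul_eq_mul, huU j hj, hvU j hj]
    ring
  have h1 : f u ≤ f ((1 / 2 : ℝ) • (u + v)) := hu hmem
  have h2 : 0 < quad C (u - v) := quad_pos hC (sub_ne_zero.2 hne.symm)
  have h3 := quad_parallelogram C u v
  have h4 : ∑ j ∈ T, h j (((1 / 2 : ℝ) • (u + v)) j) ≤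
      (∑ j ∈ T, h j (u j) + ∑ j ∈ T, h j (v j)) / 2 := by
    rw [← Finset.sum_add_distrib, Finset.sum_div]
    refine Finset.sum_le_sum fun j _ => ?_
    have h5 := hmid j (u j) (v j)
    rwa [show (u j + v j) / 2 = ((1 / 2 : ℝ) • (u + v)) j by
      simp only [PiLp.smul_apply, PiLp.add_apply, smul_eq_mul]; ring] at h5
  simp only [hf, quad_smul, WithLp.ofLp_smul, WithLp.ofLp_add, smul_dotProduct, add_dotProduct,
    smul_eq_mul] at h1 hle h4
  nlinarith

/-- Convergence of minimizers.  The coordinates in `T` are free, and their penalties converge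
continuously; the others are pinned, by penalties with slopes that tend to infinity. -/
theorem tendsto_of_forall_objective_le {C : Matrix (Fin p) (Fin p) ℝ} (hC : C.PosDef)
    {Cs : ℕ → Matrix (Fin p) (Fin p) ℝ} (hCs : Tendsto Cs atTop (𝓝 C))
    {ws : ℕ → Coef p} {w : Coef p} (hws : Tendsto ws atTop (𝓝 w))
    {T : Finset (Fin p)} {h : ℕ → Fin p → ℝ → ℝ} {h₀ : Fin p → ℝ → ℝ}
    {L : ℝ} (hL0 : 0 ≤ L) (hL : ∀ᶠ n in atTop, ∀ j ∈ T, ∀ x, -(L * (1 + |x|)) ≤ h n j x)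
    (hh : ∀ j ∈ T, ∀ x, Tendsto (fun q : ℕ × ℝ => h q.1 j q.2) (atTop ×ˢ 𝓝 x) (𝓝 (h₀ j x)))
    {cs : ℕ → Fin p → ℝ} {c : Fin p → ℝ} (hcs : ∀ j ∉ T, Tendsto (fun n => cs n j) atTop (𝓝 (c j)))
    {a : ℕ → Fin p → ℝ} (ha : ∀ j ∉ T, Tendsto (fun n => a n j) atTop atTop)
    (hpin : ∀ᶠ n in atTop, ∀ j ∉ T, ∀ x, a n j * |x - cs n j| ≤ h n j x - h n j (cs n j))
    {u : ℕ → Coef p}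
    (hu : ∀ᶠ n in atTop, ∀ v : Coef p, (∀ j ∉ T, v j = cs n j) →
      quad (Cs n) (u n) - 2 * ((u n).ofLp ⬝ᵥ (ws n).ofLp) + ∑ j, h n j (u n j) ≤
        quad (Cs n) v - 2 * (v.ofLp ⬝ᵥ (ws n).ofLp) + ∑ j, h n j (v j))
    {u₀ : Coef p} (hu₀ : IsArgmin {v | ∀ j ∉ T, v j = c j}
      (fun v => quad C v - 2 * (v.ofLp ⬝ᵥ w.ofLp) + ∑ j ∈ T, h₀ j (v j)) u₀) :
    Tendsto u atTop (𝓝 u₀) := by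
  obtain ⟨κ, hκ, hκC⟩ := exists_eventually_mul_sq_norm_le_quad hC hCs
  let f : ℕ → Coef p → ℝ := fun n v =>
    quad (Cs n) v - 2 * (v.ofLp ⬝ᵥ (ws n).ofLp) + ∑ j ∈ T, h n j (v j)
  let f₀ : Coef p → ℝ := fun v => quad C v - 2 * (v.ofLp ⬝ᵥ w.ofLp) + ∑ j ∈ T, h₀ j (v j)
  have hf : ∀ (l : Filter ℕ), l ≤ atTop → ∀ (v : ℕ → Coef p) (v₀ : Coef p),
      Tendsto v l (𝓝 v₀) → Tendsto (fun n => f n (v n)) l (𝓝 (f₀ v₀)) := by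
    intro l hl v v₀ hv
    refine Tendsto.add (Tendsto.sub ?_ (Tendsto.const_mul 2 ?_)) (tendsto_finsetSum _ fun j hj => ?_)
    · exact (continuous_quad.tendsto (C, v₀)).comp ((hCs.mono_left hl).prodMk_nhds hv)
    · simp only [dotProduct_eq_inner]
      exact hv.inner (hws.mono_left hl)
    · have hj' : Tendsto (fun n => v n j) l (𝓝 (v₀ j)) :=
        ((by fun_prop : Continuous fun x : Coef p => x j).tendsto v₀).comp hv
      exact (hh j hj (v₀ j)).comp (tendsto_id.mono_left hl |>.prodMk hj')
  -- The competitor agrees with the limit minimizer on the free coordinates and sits exactly at the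
  -- pinning values elsewhere, so it pays nothing to the steep penalties.
  let v : ℕ → Coef p := fun n => WithLp.toLp 2 fun j => if j ∈ T then u₀ j else cs n j
  have hv : Tendsto v atTop (𝓝 u₀) := by
    have h1 : Tendsto (fun n j => if j ∈ T then u₀ j else cs n j) atTop (𝓝 u₀.ofLp) := by
      refine tendsto_pi_nhds.2 fun j => ?_
      by_cases hj : j ∈ T
      · simp only [hj, if_true]; exact tendsto_const_nhds
      · simp only [hj, if_false]; rw [hu₀.1 j hj]; exact hcs j hj
    exact ((PiLp.continuous_toLp 2 fun _ : Fin p => ℝ).tendsto u₀.ofLp).comp h1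
  have hfv := hf atTop le_rfl v u₀ hv
  have hkey : ∀ᶠ n in atTop, f n (u n) + ∑ j ∈ Tᶜ, a n j * |u n j - cs n j| ≤ f n (v n) := by
    filter_upwards [hu, hpin] with n hun hpn
    have h1 := hun (v n) fun j hj => by simp [v, hj]
    rw [← Finset.sum_add_sum_compl T, ← Finset.sum_add_sum_compl T] at h1
    have h2 : ∑ j ∈ Tᶜ, a n j * |u n j - cs n j| ≤
        ∑ j ∈ Tᶜ, h n j (u n j) - ∑ j ∈ Tᶜ, h n j (v n j) := by
      rw [← Finset.sum_sub_distrib]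
      refine Finset.sum_le_sum fun j hj => ?_
      have hj' : j ∉ T := Finset.mem_compl.1 hj
      rw [show v n j = cs n j by simp [v, hj']]
      exact hpn j hj' _
    simp only [f]
    linarith
  have hapos : ∀ᶠ n in atTop, ∀ j ∈ Tᶜ, 0 ≤ a n j := by
    refine (Finset.eventually_all _).2 fun j hj => (ha j (Finset.mem_compl.1 hj)).eventually_ge_atTop 0
  have hle : ∀ᶠ n in atTop, f n (u n) ≤ f n (v n) := by
    filter_upwards [hkey, hapos] with n h1 h2
    have : 0 ≤ ∑ j ∈ Tᶜ, a n j * |u n j - cs n j| :=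
      Finset.sum_nonneg fun j hj => mul_nonneg (h2 j hj) (abs_nonneg _)
    linarith
  obtain ⟨R, hR⟩ : ∃ R, ∀ᶠ n in atTop, ‖u n‖ ≤ R := by
    refine ⟨(2 * (‖w‖ + 1) + p * L + (|f₀ u₀ + 1| + p * L)) / κ + 1, ?_⟩
    filter_upwards [hκC, hL, hle, hfv.eventually_le_const (lt_add_one _),
      hws.norm.eventually_le_const (lt_add_one _)] with n h1 h2 h3 h4 h5
    exact norm_le_of_objective_le hκ hL0 (h1 _) h2 h5 (h3.trans h4)
  -- Ultrafilters play the role of subsequences. The bounded sequence has a limit `x` along each of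
  -- them; `x` is feasible and no worse than `u₀`, hence equal to it.
  rw [tendsto_iff_ultrafilter]
  intro g hg
  obtain ⟨x, -, hx⟩ := (isCompact_closedBall (0 : Coef p) R).ultrafilter_le_nhds (g.map u)
    (by
      rw [le_principal_iff]
      exact hg (by filter_upwards [hR] with n hn; simpa using hn))
  have hx : Tendsto u g (𝓝 x) := hx
  have hfx := hf g hg u x hx
  have hxle : f₀ x ≤ f₀ u₀ :=
    le_of_tendsto_of_tendsto hfx (hfv.mono_left hg) (hle.filter_mono hg)
  have hxU : ∀ j ∉ T, x j = c j := by
    intro j hj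
    have hxj : Tendsto (fun n => u n j) g (𝓝 (x j)) :=
      ((by fun_prop : Continuous fun x : Coef p => x j).tendsto x).comp hx
    -- The gain over the competitor converges, so after division by the diverging slope it leaves no
    -- room for a deviation from the pin.
    have h1 : Tendsto (fun n => (f n (v n) - f n (u n)) / a n j) g (𝓝 0) :=
      ((hfv.mono_left hg).sub hfx).div_atTop ((ha j hj).mono_left hg)
    have h2 : Tendsto (fun n => |u n j - cs n j|) g (𝓝 0) := by
      refine squeeze_zero' (Eventually.of_forall fun _ => abs_nonneg _) ?_ h1
      filter_upwards [hkey.filter_mono hg, hapos.filter_mono hg,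
        ((ha j hj).eventually_gt_atTop 0).filter_mono hg] with n h3 h4 h5
      rw [le_div_iff₀ h5]
      have h6 : a n j * |u n j - cs n j| ≤ ∑ j ∈ Tᶜ, a n j * |u n j - cs n j| :=
        Finset.single_le_sum (f := fun j => a n j * |u n j - cs n j|)
          (fun j hj => mul_nonneg (h4 j hj) (abs_nonneg _)) (Finset.mem_compl.2 hj)
      linarith
    have h3 := tendsto_nhds_unique h2 (hxj.sub ((hcs j hj).mono_left hg)).abs
    exact sub_eq_zero.1 (abs_eq_zero.1 h3.symm)
  have : x = u₀ := by
    by_contra hne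
    exact absurd (hu₀.2 x hxU hne) (not_lt.2 hxle)
  exact this ▸ hx

end Argmin

/-! ### Coordinate penalties and the limit objective -/

section Penalty

/-- The one-sided directional derivative of `|·|` at `b` in the direction `x`. -/
noncomputable def absDeriv (b x : ℝ) : ℝ :=
  if b = 0 then |x| else SignType.sign b * x

theorem abs_absDeriv_le (b x : ℝ) : |absDeriv b x| ≤ |x| := by
  unfold absDeriv
  split_ifs with h
  · rw [abs_abs]
  · rcases lt_or_gt_of_ne h with h | h <;> simp [h]

theorem continuous_absDeriv (b : ℝ) : Continuous (absDeriv b) := by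
  unfold absDeriv
  split_ifs <;> fun_prop

theorem absDeriv_midpoint_le (b x y : ℝ) :
    absDeriv b ((x + y) / 2) ≤ (absDeriv b x + absDeriv b y) / 2 := by
  unfold absDeriv
  split_ifs with h
  · rw [abs_div, abs_two]
    linarith [abs_add_le x y]
  · linarith

/-- As long as `|x|` does not exceed `s |b|`, the argument does not cross the kink. The increment
thus equals the directional derivative exactly, with no remainder. -/
theorem abs_add_sub_abs_eq_absDeriv {b s x : ℝ} (hs : 0 < s) (hx : b ≠ 0 → |x| ≤ s * |b|) :
    |s * b + x| - |s * b| = absDeriv b x := by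
  unfold absDeriv
  split_ifs with h
  · simp [h]
  have hx := abs_le.1 (hx h)
  rcases lt_or_gt_of_ne h with hb | hb
  · rw [abs_of_neg hb] at hx
    rw [abs_of_nonpos (by nlinarith), abs_of_nonpos (mul_nonpos_of_nonneg_of_nonpos hs.le hb.le)]
    simp [hb]
  · rw [abs_of_pos hb] at hx
    rw [abs_of_nonneg (by nlinarith), abs_of_nonneg (mul_nonneg hs.le hb.le)]
    simp [hb]

/-- The limit of the penalties of a coordinate. -/
noncomputable def limitPenalty (b A B d x : ℝ) : ℝ :=
  A * absDeriv b x + B * |x - d|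

theorem tendsto_limitPenalty (b : ℝ) {A B d : ℕ → ℝ} {A₀ B₀ d₀ : ℝ} (hA : Tendsto A atTop (𝓝 A₀))
    (hB : Tendsto B atTop (𝓝 B₀)) (hd : Tendsto d atTop (𝓝 d₀)) (x : ℝ) :
    Tendsto (fun q : ℕ × ℝ => limitPenalty b (A q.1) (B q.1) (d q.1) q.2) (atTop ×ˢ 𝓝 x)
      (𝓝 (limitPenalty b A₀ B₀ d₀ x)) := by
  unfold limitPenalty
  have h2 : Tendsto (fun q : ℕ × ℝ => q.2) (atTop ×ˢ 𝓝 x) (𝓝 x) := tendsto_snd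
  exact ((hA.comp tendsto_fst).mul (((continuous_absDeriv b).tendsto x).comp h2)).add
    ((hB.comp tendsto_fst).mul (h2.sub (hd.comp tendsto_fst)).abs)

theorem neg_le_limitPenalty {b A B d x L : ℝ} (hA : 0 ≤ A) (hB : 0 ≤ B) (hL : A ≤ L) :
    -(L * (1 + |x|)) ≤ limitPenalty b A B d x := by
  unfold limitPenalty
  have h1 := (abs_le.1 (abs_absDeriv_le b x)).1
  have h2 : 0 ≤ B * |x - d| := by positivity
  nlinarith [abs_nonneg x]

/-- The minimizer of the limit objective exists, and it depends continuously on the parameters. -/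
theorem exists_continuous_isArgmin {p : ℕ} {C : Matrix (Fin p) (Fin p) ℝ} (hC : C.PosDef)
    (b : Coef p) (T : Finset (Fin p)) :
    ∃ g : Coef p × (Fin p → ℝ) × (Fin p → ℝ) × (Fin p → ℝ) × (Fin p → ℝ) → Coef p, Continuous g ∧
      ∀ (w : Coef p) (A B d c : Fin p → ℝ), (∀ j, 0 ≤ A j) → (∀ j, 0 ≤ B j) →
        IsArgmin {v | ∀ j ∉ T, v j = c j} (fun v => quad C v - 2 * (v.ofLp ⬝ᵥ w.ofLp)
          + ∑ j ∈ T, limitPenalty (b j) (A j) (B j) (d j) (v j)) (g (w, A, B, d, c)) := by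
  -- The absolute values of the weights keep the problem convex for all parameters, so that the
  -- minimizer is defined and continuous on the whole parameter space.
  have hex : ∀ θ : Coef p × (Fin p → ℝ) × (Fin p → ℝ) × (Fin p → ℝ) × (Fin p → ℝ), ∃ u,
      IsArgmin {v | ∀ j ∉ T, v j = θ.2.2.2.2 j} (fun v => quad C v - 2 * (v.ofLp ⬝ᵥ θ.1.ofLp)
        + ∑ j ∈ T, limitPenalty (b j) |θ.2.1 j| |θ.2.2.1 j| (θ.2.2.2.1 j) (v j)) u := by
    rintro ⟨w, A, B, d, c⟩
    refine exists_isArgmin hC w c T (h := fun j => limitPenalty (b j) |A j| |B j| (d j))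
      (L := ∑ j, |A j|) (fun j => ?_) (fun j x y => ?_) (by positivity) (fun j _ x => ?_)
    · unfold limitPenalty
      have := continuous_absDeriv (b j)
      fun_prop
    · unfold limitPenalty
      have h1 := absDeriv_midpoint_le (b j) x y
      have h2 : |(x + y) / 2 - d j| ≤ (|x - d j| + |y - d j|) / 2 := by
        rw [show (x + y) / 2 - d j = ((x - d j) + (y - d j)) / 2 by ring, abs_div, abs_two]
        linarith [abs_add_le (x - d j) (y - d j)]
      have h3 := mul_le_mul_of_nonneg_left h1 (abs_nonneg (A j))
      have h4 := mul_le_mul_of_nonneg_left h2 (abs_nonneg (B j))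
      linarith
    · exact neg_le_limitPenalty (abs_nonneg _) (abs_nonneg _)
        (Finset.single_le_sum (f := fun j => |A j|) (fun _ _ => abs_nonneg _) (Finset.mem_univ j))
  choose g hg using hex
  refine ⟨g, ?_, fun w A B d c hA hB => ?_⟩
  swap
  · have := hg (w, A, B, d, c)
    simpa only [abs_of_nonneg (hA _), abs_of_nonneg (hB _)] using this
  refine continuous_iff_continuousAt.2 fun θ => tendsto_of_seq_tendsto fun x hx => ?_
  have hw : Tendsto (fun n => (x n).1) atTop (𝓝 θ.1) := (continuous_fst.tendsto θ).comp hx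
  have hA : ∀ j, Tendsto (fun n => |(x n).2.1 j|) atTop (𝓝 |θ.2.1 j|) := fun j =>
    ((by fun_prop : Continuous fun θ : Coef p × (Fin p → ℝ) × (Fin p → ℝ) × (Fin p → ℝ) ×
      (Fin p → ℝ) => |θ.2.1 j|).tendsto θ).comp hx
  have hB : ∀ j, Tendsto (fun n => |(x n).2.2.1 j|) atTop (𝓝 |θ.2.2.1 j|) := fun j =>
    ((by fun_prop : Continuous fun θ : Coef p × (Fin p → ℝ) × (Fin p → ℝ) × (Fin p → ℝ) ×
      (Fin p → ℝ) => |θ.2.2.1 j|).tendsto θ).comp hx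
  have hd : ∀ j, Tendsto (fun n => (x n).2.2.2.1 j) atTop (𝓝 (θ.2.2.2.1 j)) := fun j =>
    ((by fun_prop : Continuous fun θ : Coef p × (Fin p → ℝ) × (Fin p → ℝ) × (Fin p → ℝ) ×
      (Fin p → ℝ) => θ.2.2.2.1 j).tendsto θ).comp hx
  have hc : ∀ j, Tendsto (fun n => (x n).2.2.2.2 j) atTop (𝓝 (θ.2.2.2.2 j)) := fun j =>
    ((by fun_prop : Continuous fun θ : Coef p × (Fin p → ℝ) × (Fin p → ℝ) × (Fin p → ℝ) ×
      (Fin p → ℝ) => θ.2.2.2.2 j).tendsto θ).comp hx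
  -- Artificial penalties of slope `n` encode the hard constraints. They vanish at feasible points,
  -- so continuity becomes an instance of the convergence of minimizers.
  let h : ℕ → Fin p → ℝ → ℝ := fun n j t => if j ∈ T then
    limitPenalty (b j) |(x n).2.1 j| |(x n).2.2.1 j| ((x n).2.2.2.1 j) t
    else n * |t - (x n).2.2.2.2 j|
  refine tendsto_of_forall_objective_le hC (Cs := fun _ => C) tendsto_const_nhds hw (T := T)
    (h := h) (h₀ := fun j => limitPenalty (b j) |θ.2.1 j| |θ.2.2.1 j| (θ.2.2.2.1 j))
    (L := ∑ j, (|θ.2.1 j| + 1)) (by positivity) ?_ (fun j hj t => ?_)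
    (fun j _ => hc j) (a := fun n _ => n) (fun j _ => tendsto_natCast_atTop_atTop) ?_ ?_ (hg θ)
  · have hev : ∀ᶠ n in atTop, ∀ j, |(x n).2.1 j| ≤ |θ.2.1 j| + 1 :=
      eventually_all.2 fun j => (hA j).eventually_le_const (lt_add_one _)
    filter_upwards [hev] with n hn j hj t
    simp only [h, hj, if_true]
    refine neg_le_limitPenalty (abs_nonneg _) (abs_nonneg _) ((hn j).trans ?_)
    exact Finset.single_le_sum (f := fun j => |θ.2.1 j| + 1) (fun _ _ => by positivity)
      (Finset.mem_univ j)
  · simp only [h, hj, if_true]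
    exact tendsto_limitPenalty (b j) (hA j) (hB j) (hd j) t
  · refine Eventually.of_forall fun n j hj t => ?_
    simp [h, hj]
  · refine Eventually.of_forall fun n v hv => ?_
    have hsum : ∀ v : Coef p, (∀ j ∉ T, v j = (x n).2.2.2.2 j) → ∑ j, h n j (v j) =
        ∑ j ∈ T, limitPenalty (b j) |(x n).2.1 j| |(x n).2.2.1 j| ((x n).2.2.2.1 j) (v j) := by
      intro v hv
      rw [← Finset.sum_add_sum_compl T]
      have h1 : ∑ j ∈ Tᶜ, h n j (v j) = 0 := Finset.sum_eq_zero fun j hj => by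
        have hj' := Finset.mem_compl.1 hj
        simp [h, hj', hv j hj']
      rw [h1, add_zero]
      exact Finset.sum_congr rfl fun j hj => by simp [h, hj]
    simp only [Function.comp_apply]
    rw [hsum v hv, hsum _ (hg (x n)).1]
    rcases eq_or_ne v (g (x n)) with rfl | hne
    · exact le_rfl
    · exact ((hg (x n)).2 v hv hne).le

end Penalty

/-! ### The basic inequality in rescaled coordinates -/

section Reduction

variable {n p : ℕ}

/-- The objective, multiplied by `s ^ 2`, for real weights `A` of the adaptive penalty. -/
noncomputable def realObjective (X : Matrix (Fin n) (Fin p) ℝ) (y : Fin n → ℝ) (βt : Coef p)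
    (s eta γ₂ : ℝ) (A : Fin p → ℝ) (β : Coef p) : ℝ :=
  s ^ 2 * (1 / n * ‖WithLp.toLp 2 (y - X *ᵥ β.ofLp)‖ ^ 2)
    + ∑ j, s * A j * |β j| + ∑ j, s * (s * eta / n * |βt j| ^ γ₂) * |β j - βt j|

variable {X : Matrix (Fin n) (Fin p) ℝ} {y : Fin n → ℝ} {βt : Coef p}
  {s lam eta γ₁ γ₂ : ℝ} {A : Fin p → ℝ}

theorem realObjective_nonneg (hs : 0 < s) (heta : 0 ≤ eta) (hA0 : ∀ j, 0 ≤ A j) (β : Coef p) :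
    0 ≤ realObjective X y βt s eta γ₂ A β := by
  have h1 : 0 ≤ ∑ j, s * A j * |β j| := Finset.sum_nonneg fun j _ =>
    mul_nonneg (mul_nonneg hs.le (hA0 j)) (abs_nonneg _)
  unfold realObjective
  positivity

theorem ofReal_realObjective (hs : 0 < s) (heta : 0 ≤ eta) (hA0 : ∀ j, 0 ≤ A j) (β : Coef p) :
    ENNReal.ofReal (realObjective X y βt s eta γ₂ A β) =
      ENNReal.ofReal s ^ 2 * ENNReal.ofReal (1 / n * ‖WithLp.toLp 2 (y - X *ᵥ β.ofLp)‖ ^ 2)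
        + ∑ j, ENNReal.ofReal s * ENNReal.ofReal (A j) * ENNReal.ofReal |β j|
        + ∑ j, ENNReal.ofReal s ^ 2 * (ENNReal.ofReal (eta / n) *
          (ENNReal.ofReal (|βt j| ^ γ₂) * ENNReal.ofReal |β j - βt j|)) := by
  have h1 : ∀ j ∈ Finset.univ, 0 ≤ s * A j * |β j| := fun j _ =>
    mul_nonneg (mul_nonneg hs.le (hA0 j)) (abs_nonneg _)
  unfold realObjective
  rw [ENNReal.ofReal_add (add_nonneg (by positivity) (Finset.sum_nonneg h1)) (by positivity),
    ENNReal.ofReal_add (by positivity) (Finset.sum_nonneg h1),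
    ENNReal.ofReal_sum_of_nonneg h1, ENNReal.ofReal_sum_of_nonneg (fun j _ => by positivity),
    ENNReal.ofReal_mul (by positivity), ENNReal.ofReal_pow hs.le]
  congr 1
  · congr 1
    refine Finset.sum_congr rfl fun j _ => ?_
    rw [ENNReal.ofReal_mul (mul_nonneg hs.le (hA0 j)), ENNReal.ofReal_mul hs.le]
  · refine Finset.sum_congr rfl fun j _ => ?_
    rw [← ENNReal.ofReal_mul (by positivity), ← ENNReal.ofReal_mul (by positivity),
      ← ENNReal.ofReal_pow hs.le, ← ENNReal.ofReal_mul (by positivity)]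
    congr 1
    ring

theorem sq_mul_objective (hs : 0 < s) (β : Coef p) :
    ENNReal.ofReal s ^ 2 * objective X y βt lam eta γ₁ γ₂ β =
      ENNReal.ofReal s ^ 2 * ENNReal.ofReal (1 / n * ‖WithLp.toLp 2 (y - X *ᵥ β.ofLp)‖ ^ 2)
        + ∑ j, ENNReal.ofReal s * (ENNReal.ofReal (s * lam / n) *
          (ENNReal.ofReal (|βt j| ^ γ₁))⁻¹) * ENNReal.ofReal |β j|
        + ∑ j, ENNReal.ofReal s ^ 2 * (ENNReal.ofReal (eta / n) *
          (ENNReal.ofReal (|βt j| ^ γ₂) * ENNReal.ofReal |β j - βt j|)) := by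
  unfold objective
  rw [mul_add, mul_add, Finset.mul_sum, Finset.mul_sum, Finset.mul_sum, Finset.mul_sum]
  congr 2
  refine Finset.sum_congr rfl fun j _ => ?_
  rw [mul_div_assoc, ENNReal.ofReal_mul hs.le]
  ring

theorem response_sub_mulVec (X : Matrix (Fin n) (Fin p) ℝ) (βs β : Coef p) (e : Fin n → ℝ) :
    response X βs e - X *ᵥ β.ofLp = e - X *ᵥ (β - βs).ofLp := by
  rw [response, WithLp.ofLp_sub, Matrix.mulVec_sub]
  abel

/-- The residual sum of squares in terms of the rescaled coefficients `u = s (β - βs)`. -/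
theorem sq_mul_residual (hn : 0 < n) (X : Matrix (Fin n) (Fin p) ℝ) (βs β : Coef p)
    (e : Fin n → ℝ) (s : ℝ) :
    s ^ 2 * (1 / n * ‖WithLp.toLp 2 (response X βs e - X *ᵥ β.ofLp)‖ ^ 2) =
      s ^ 2 * (1 / n * (e ⬝ᵥ e)) + quad ((1 / n : ℝ) • (Xᵀ * X)) (s • (β - βs))
        - 2 * ((s • (β - βs)).ofLp ⬝ᵥ ((s / √(n : ℝ)) • score X e).ofLp) := by
  have hn' : (0 : ℝ) < n := Nat.cast_pos.2 hn
  set d := β - βs with hd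
  rw [response_sub_mulVec, ← hd, EuclideanSpace.real_norm_sq_eq]
  have h1 : ∑ i, (WithLp.toLp 2 (e - X *ᵥ d.ofLp)).ofLp i ^ 2 =
      e ⬝ᵥ e - 2 * (e ⬝ᵥ (X *ᵥ d.ofLp)) + (X *ᵥ d.ofLp) ⬝ᵥ (X *ᵥ d.ofLp) := by
    simp only [dotProduct, Pi.sub_apply, Finset.mul_sum]
    rw [← Finset.sum_sub_distrib, ← Finset.sum_add_distrib]
    exact Finset.sum_congr rfl fun i _ => by ring
  have h2 : quad ((1 / n : ℝ) • (Xᵀ * X)) d = 1 / n * ((X *ᵥ d.ofLp) ⬝ᵥ (X *ᵥ d.ofLp)) := by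
    rw [quad, Matrix.smul_mulVec, dotProduct_smul, ← Matrix.mulVec_mulVec,
      Matrix.dotProduct_mulVec, Matrix.vecMul_transpose, smul_eq_mul]
  have h3 : d.ofLp ⬝ᵥ (Xᵀ *ᵥ e) = e ⬝ᵥ (X *ᵥ d.ofLp) := by
    rw [Matrix.dotProduct_mulVec, Matrix.vecMul_transpose, dotProduct_comm]
  have h4 : s / √(n : ℝ) * (1 / √(n : ℝ)) = s / n := by
    rw [div_mul_div_comm, Real.mul_self_sqrt hn'.le, mul_one]
  rw [h1, quad_smul, h2, score, smul_smul, h4]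
  simp only [WithLp.ofLp_smul, smul_dotProduct, dotProduct_smul, smul_eq_mul, h3]
  field_simp
  ring

/-- The basic inequality of an estimate, in terms of the rescaled coefficients `u = s (β - βs)`.
The weights `A` of the adaptive penalty may be smaller than the true (possibly infinite) ones at the
coordinates where the competitor vanishes. -/
theorem IsEstimate.rescaled_le (hn : 0 < n) (hs : 0 < s) (heta : 0 ≤ eta) {βs βh : Coef p}
    {e : Fin n → ℝ} (h : IsEstimate X (response X βs e) βt lam eta γ₁ γ₂ βh) (hA0 : ∀ j, 0 ≤ A j)
    (hA : ∀ j, ENNReal.ofReal (A j) ≤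
      ENNReal.ofReal (s * lam / n) * (ENNReal.ofReal (|βt j| ^ γ₁))⁻¹) {v : Coef p}
    (hv : ∀ j, s * βs j + v j = 0 ∨ ENNReal.ofReal (A j) =
      ENNReal.ofReal (s * lam / n) * (ENNReal.ofReal (|βt j| ^ γ₁))⁻¹) :
    quad ((1 / n : ℝ) • (Xᵀ * X)) (s • (βh - βs))
        - 2 * ((s • (βh - βs)).ofLp ⬝ᵥ ((s / √(n : ℝ)) • score X e).ofLp)
        + ∑ j, (A j * (|s * βs j + (s • (βh - βs)) j| - |s * βs j|)
          + s * eta / n * |βt j| ^ γ₂ * |(s • (βh - βs)) j - s * (βt j - βs j)|) ≤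
      quad ((1 / n : ℝ) • (Xᵀ * X)) v - 2 * (v.ofLp ⬝ᵥ ((s / √(n : ℝ)) • score X e).ofLp)
        + ∑ j, (A j * (|s * βs j + v j| - |s * βs j|)
          + s * eta / n * |βt j| ^ γ₂ * |v j - s * (βt j - βs j)|) := by
  set b : Coef p := βs + s⁻¹ • v with hb
  have hbv : v = s • (b - βs) := by
    rw [hb, add_sub_cancel_left, smul_smul, mul_inv_cancel₀ hs.ne', one_smul]
  have hbj : ∀ j, s * βs j + v j = s * b j := by
    intro j
    rw [hbv, PiLp.smul_apply, PiLp.sub_apply, smul_eq_mul]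
    ring
  -- Lowering the weights can only lower the value at the estimate, and it leaves the value at the
  -- competitor unchanged, since there each weight is exact or multiplies `0`. Both ends of the
  -- chain are finite, so the comparison descends to the reals.
  have key : realObjective X (response X βs e) βt s eta γ₂ A βh ≤
      realObjective X (response X βs e) βt s eta γ₂ A b := by
    rw [← ENNReal.ofReal_le_ofReal_iff (realObjective_nonneg hs heta hA0 b)]
    calc ENNReal.ofReal (realObjective X (response X βs e) βt s eta γ₂ A βh)
        ≤ ENNReal.ofReal s ^ 2 * objective X (response X βs e) βt lam eta γ₁ γ₂ βh := by
          rw [ofReal_realObjective hs heta hA0, sq_mul_objective hs]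
          gcongr with j
          exact hA j
      _ ≤ ENNReal.ofReal s ^ 2 * objective X (response X βs e) βt lam eta γ₁ γ₂ b := by
          gcongr
          exact h b
      _ = ENNReal.ofReal (realObjective X (response X βs e) βt s eta γ₂ A b) := by
          rw [ofReal_realObjective hs heta hA0, sq_mul_objective hs]
          congr 2
          refine Finset.sum_congr rfl fun j _ => ?_
          rcases hv j with h0 | h0
          · rw [hbj, mul_eq_zero, or_iff_right hs.ne'] at h0
            simp [h0]
          · rw [h0]
  have hexp : ∀ β : Coef p, realObjective X (response X βs e) βt s eta γ₂ A β =
      quad ((1 / n : ℝ) • (Xᵀ * X)) (s • (β - βs))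
        - 2 * ((s • (β - βs)).ofLp ⬝ᵥ ((s / √(n : ℝ)) • score X e).ofLp)
        + ∑ j, (A j * (|s * βs j + (s • (β - βs)) j| - |s * βs j|)
          + s * eta / n * |βt j| ^ γ₂ * |(s • (β - βs)) j - s * (βt j - βs j)|)
        + (s ^ 2 * (1 / n * (e ⬝ᵥ e)) + ∑ j, A j * |s * βs j|) := by
    intro β
    have h1 : ∑ j, (A j * (|s * βs j + (s • (β - βs)) j| - |s * βs j|)
          + s * eta / n * |βt j| ^ γ₂ * |(s • (β - βs)) j - s * (βt j - βs j)|) =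
        ∑ j, s * A j * |β j| + ∑ j, s * (s * eta / n * |βt j| ^ γ₂) * |β j - βt j|
          - ∑ j, A j * |s * βs j| := by
      rw [← Finset.sum_add_distrib, ← Finset.sum_sub_distrib]
      refine Finset.sum_congr rfl fun j _ => ?_
      rw [PiLp.smul_apply, PiLp.sub_apply, smul_eq_mul,
        show s * βs j + s * (β j - βs j) = s * β j by ring,
        show s * (β j - βs j) - s * (βt j - βs j) = s * (β j - βt j) by ring,
        abs_mul s (β j), abs_mul s (β j - βt j), abs_of_pos hs]
      ring
    rw [h1, realObjective, sq_mul_residual hn]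
    ring
  rw [hexp, hexp, ← hbv] at key
  linarith

end Reduction

/-! ### Finite lower bounds for possibly infinite weights -/

section Weights

theorem ofReal_div_eq_weight {l t : ℝ} (ht : 0 < t) :
    ENNReal.ofReal (l / t) = ENNReal.ofReal l * (ENNReal.ofReal t)⁻¹ := by
  rw [ENNReal.ofReal_div_of_pos ht, div_eq_mul_inv]

/-- For `t = 0` the right side is `∞` if `l > 0`, but `0 * ∞ = 0` otherwise, whence the last
hypothesis. -/
theorem ofReal_le_weight {A l t : ℝ} (ht : 0 ≤ t) (h : A * t ≤ l) (h0 : A ≤ 0 ∨ 0 < l) :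
    ENNReal.ofReal A ≤ ENNReal.ofReal l * (ENNReal.ofReal t)⁻¹ := by
  rcases h0 with h0 | h0
  · simp [ENNReal.ofReal_of_nonpos h0]
  rcases ht.eq_or_lt with rfl | ht
  · have hl : ENNReal.ofReal l ≠ 0 := by simpa using h0
    simp [ENNReal.mul_top hl]
  · rw [← ofReal_div_eq_weight ht]
    exact ENNReal.ofReal_le_ofReal ((le_div_iff₀ ht).2 h)

end Weights

/-! ### Deterministic convergence of realized estimates -/

/-- Realizations of adaptive transfer lasso estimates `βh i` with sample sizes `N i` and `m i`, along
which the rescaled initial estimates converge to `z` and the score vectors to `w`. -/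
structure IsEstimateSeq {p : ℕ} (βs : Coef p) (γ₁ γ₂ r₀ : ℝ) (C : Matrix (Fin p) (Fin p) ℝ)
    (z w : Coef p) (N m : ℕ → ℕ) (X : (i : ℕ) → Matrix (Fin (N i)) (Fin p) ℝ)
    (e : (i : ℕ) → Fin (N i) → ℝ) (lam eta : ℕ → ℝ) (βt βh : ℕ → Coef p) : Prop where
  posDef : C.PosDef
  gamma₁_nonneg : 0 ≤ γ₁
  gamma₂_nonneg : 0 ≤ γ₂
  tendsto_size : Tendsto N atTop atTop
  source_pos : ∀ᶠ i in atTop, 0 < m i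
  tendsto_ratio : Tendsto (fun i => (N i : ℝ) / m i) atTop (𝓝 r₀)
  tendsto_gram : Tendsto (fun i => (1 / N i : ℝ) • ((X i)ᵀ * X i)) atTop (𝓝 C)
  tendsto_score : Tendsto (fun i => score (X i) (e i)) atTop (𝓝 w)
  tendsto_initial : Tendsto (fun i => √(m i : ℝ) • (βt i - βs)) atTop (𝓝 z)
  lam_nonneg : ∀ i, 0 ≤ lam i
  eta_nonneg : ∀ i, 0 ≤ eta i
  isEstimate : ∀ i, IsEstimate (X i) (response (X i) βs (e i)) (βt i) (lam i) (eta i) γ₁ γ₂ (βh i)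

namespace IsEstimateSeq

variable {p : ℕ} {βs : Coef p} {γ₁ γ₂ r₀ : ℝ} {C : Matrix (Fin p) (Fin p) ℝ} {z w : Coef p}
  {N m : ℕ → ℕ} {X : (i : ℕ) → Matrix (Fin (N i)) (Fin p) ℝ} {e : (i : ℕ) → Fin (N i) → ℝ}
  {lam eta : ℕ → ℝ} {βt βh : ℕ → Coef p}

section Generic

/-- Convergence of rescaled estimates when the coordinates in `T` are asymptotically free and the
others are pinned, at `0` if `βs j = 0` and at the initial estimate otherwise. -/
theorem tendsto_smul_sub (H : IsEstimateSeq βs γ₁ γ₂ r₀ C z w N m X e lam eta βt βh)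
    {T : Finset (Fin p)} {s : ℕ → ℝ} (hs : Tendsto s atTop atTop) {τ : ℝ}
    (hτ : Tendsto (fun i => s i / √(N i : ℝ)) atTop (𝓝 τ)) {A : ℕ → Fin p → ℝ}
    (hA0 : ∀ᶠ i in atTop, ∀ j, 0 ≤ A i j)
    (hA : ∀ᶠ i in atTop, ∀ j, ENNReal.ofReal (A i j) ≤
      ENNReal.ofReal (s i * lam i / N i) * (ENNReal.ofReal (|βt i j| ^ γ₁))⁻¹)
    (hAeq : ∀ᶠ i in atTop, ∀ j, j ∈ T ∨ βs j ≠ 0 → ENNReal.ofReal (A i j) =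
      ENNReal.ofReal (s i * lam i / N i) * (ENNReal.ofReal (|βt i j| ^ γ₁))⁻¹)
    {A₀ B₀ d₀ c : Fin p → ℝ}
    (hAlim : ∀ j ∈ T, Tendsto (fun i => A i j) atTop (𝓝 (A₀ j)))
    (hBlim : ∀ j ∈ T, Tendsto (fun i => s i * eta i / N i * |βt i j| ^ γ₂) atTop (𝓝 (B₀ j)))
    (hdlim : ∀ j ∈ T, Tendsto (fun i => s i * (βt i j - βs j)) atTop (𝓝 (d₀ j)))
    (hzero : ∀ j ∉ T, βs j = 0 → c j = 0 ∧
      Tendsto (fun i => A i j - s i * eta i / N i * |βt i j| ^ γ₂) atTop atTop)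
    (hnonzero : ∀ j ∉ T, βs j ≠ 0 → Tendsto (fun i => s i * (βt i j - βs j)) atTop (𝓝 (c j)) ∧
      Tendsto (fun i => s i * eta i / N i * |βt i j| ^ γ₂ - A i j) atTop atTop)
    {u₀ : Coef p} (hu₀ : IsArgmin {v | ∀ j ∉ T, v j = c j}
      (fun v => quad C v - 2 * (v.ofLp ⬝ᵥ (τ • w).ofLp)
        + ∑ j ∈ T, limitPenalty (βs j) (A₀ j) (B₀ j) (d₀ j) (v j)) u₀) :
    Tendsto (fun i => s i • (βh i - βs)) atTop (𝓝 u₀) := by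
  have hN : ∀ᶠ i in atTop, 0 < N i := H.tendsto_size.eventually_gt_atTop 0
  have hspos : ∀ᶠ i in atTop, 0 < s i := hs.eventually_gt_atTop 0
  have hB0 : ∀ᶠ i in atTop, ∀ j, 0 ≤ s i * eta i / N i * |βt i j| ^ γ₂ := by
    filter_upwards [hspos] with i hi j
    have := H.eta_nonneg i
    positivity
  refine tendsto_of_forall_objective_le H.posDef H.tendsto_gram (hτ.smul H.tendsto_score) (T := T)
    (h := fun i j x => A i j * (|s i * βs j + x| - |s i * βs j|)
      + s i * eta i / N i * |βt i j| ^ γ₂ * |x - s i * (βt i j - βs j)|)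
    (h₀ := fun j => limitPenalty (βs j) (A₀ j) (B₀ j) (d₀ j))
    (L := ∑ j, (|A₀ j| + 1)) (by positivity) ?_ (fun j hj x => ?_)
    (cs := fun i j => if βs j = 0 then 0 else s i * (βt i j - βs j)) (fun j hj => ?_)
    (a := fun i j => if βs j = 0 then A i j - s i * eta i / N i * |βt i j| ^ γ₂
      else s i * eta i / N i * |βt i j| ^ γ₂ - A i j) (fun j hj => ?_) ?_ ?_ hu₀
  · have hev : ∀ᶠ i in atTop, ∀ j ∈ T, A i j ≤ A₀ j + 1 :=
      (Finset.eventually_all T).2 fun j hj => (hAlim j hj).eventually_le_const (lt_add_one _)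
    filter_upwards [hev, hA0, hB0] with i h1 h2 h3 j hj x
    have h4 : A i j ≤ ∑ j, (|A₀ j| + 1) := by
      refine ((h1 j hj).trans ?_).trans (Finset.single_le_sum (f := fun j => |A₀ j| + 1)
        (fun _ _ => by positivity) (Finset.mem_univ j))
      linarith [le_abs_self (A₀ j)]
    have h5 : -|x| ≤ |s i * βs j + x| - |s i * βs j| := by
      have := abs_sub_abs_le_abs_sub (s i * βs j) (s i * βs j + x)
      rw [sub_add_cancel_left, abs_neg] at this
      linarith
    have h6 := mul_nonneg (h3 j) (abs_nonneg (x - s i * (βt i j - βs j)))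
    have h7 := mul_le_mul_of_nonneg_left h5 (h2 j)
    have h8 := mul_le_mul_of_nonneg_right h4 (abs_nonneg x)
    have h9 := (h2 j).trans h4
    linarith
  -- Near a fixed `x`, the adaptive increment equals its directional derivative as soon as `s |β*_j|
  -- ≥ |x| + 1`.
  · refine (tendsto_limitPenalty (βs j) (hAlim j hj) (hBlim j hj) (hdlim j hj) x).congr' ?_
    have h1 : ∀ᶠ q : ℕ × ℝ in atTop ×ˢ 𝓝 x, |q.2| < |x| + 1 :=
      (continuous_abs.tendsto x).comp tendsto_snd |>.eventually_lt_const (lt_add_one _)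
    have h2 : ∀ᶠ q : ℕ × ℝ in atTop ×ˢ 𝓝 x, 0 < s q.1 ∧ (βs j ≠ 0 → |x| + 1 ≤ s q.1 * |βs j|) := by
      refine tendsto_fst.eventually (p := fun i => 0 < s i ∧ (βs j ≠ 0 → |x| + 1 ≤ s i * |βs j|)) ?_
      refine hspos.and ?_
      by_cases hb : βs j = 0
      · exact Eventually.of_forall fun _ h => absurd hb h
      · filter_upwards [(hs.atTop_mul_const (abs_pos.2 hb)).eventually_ge_atTop (|x| + 1)] with i hi _
        exact hi
    filter_upwards [h1, h2] with q h3 h4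
    rw [abs_add_sub_abs_eq_absDeriv h4.1 fun hb => h3.le.trans (h4.2 hb), limitPenalty]
  · by_cases hb : βs j = 0
    · simp only [hb, if_true, (hzero j hj hb).1]
      exact tendsto_const_nhds
    · simp only [hb, if_false]
      exact (hnonzero j hj hb).1
  · by_cases hb : βs j = 0
    · simp only [hb, if_true]
      exact (hzero j hj hb).2
    · simp only [hb, if_false]
      exact (hnonzero j hj hb).2
  -- At either kink the other penalty can fall at a rate of at most its own weight, by the triangle
  -- inequality. The difference of the weights is therefore a valid pinning slope.
  · filter_upwards [hA0, hB0] with i h1 h2 j hj x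
    by_cases hb : βs j = 0
    · simp only [hb, if_true, mul_zero, zero_add, abs_zero, sub_zero, zero_sub, abs_neg]
      have := abs_sub_abs_le_abs_sub (s i * βt i j) (s i * βt i j - x)
      rw [sub_sub_cancel, abs_sub_comm _ x] at this
      linarith [mul_le_mul_of_nonneg_left this (h2 j)]
    · simp only [hb, if_false, sub_self, abs_zero, mul_zero, add_zero]
      have := abs_sub_abs_le_abs_sub (s i * βs j + s i * (βt i j - βs j)) (s i * βs j + x)
      rw [add_sub_add_left_eq_sub, abs_sub_comm _ x] at this
      linarith [mul_le_mul_of_nonneg_left this (h1 j)]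
  · filter_upwards [hN, hspos, hA0, hA, hAeq] with i h1 h2 h3 h4 h5 v hv
    refine (H.isEstimate i).rescaled_le h1 h2 (H.eta_nonneg i) h3 h4 fun j => ?_
    by_cases hj : j ∈ T ∨ βs j ≠ 0
    · exact Or.inr (h5 j hj)
    · push Not at hj
      left
      rw [hv j hj.1, hj.2]
      simp

theorem quad_add_ge (C : Matrix (Fin p) (Fin p) ℝ) (c r : Coef p) :
    quad C c + quad C r - 2 * (∑ i, ∑ j, |C i j|) * ‖c‖ * ‖r‖ ≤ quad C (c + r) := by
  have h1 : quad C (c + r) - quad C c - quad C r =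
      ∑ i, ∑ j, (r i * (C i j * c j) + c i * (C i j * r j)) := by
    simp only [quad_eq_sum, PiLp.add_apply, ← Finset.sum_sub_distrib]
    exact Finset.sum_congr rfl fun i _ => Finset.sum_congr rfl fun j _ => by ring
  have h2 : |∑ i, ∑ j, (r i * (C i j * c j) + c i * (C i j * r j))| ≤
      2 * (∑ i, ∑ j, |C i j|) * ‖c‖ * ‖r‖ := by
    rw [mul_assoc, mul_assoc, mul_left_comm, Finset.sum_mul]
    refine (Finset.abs_sum_le_sum_abs _ _).trans (Finset.sum_le_sum fun i _ => ?_)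
    rw [Finset.sum_mul]
    refine (Finset.abs_sum_le_sum_abs _ _).trans (Finset.sum_le_sum fun j _ => ?_)
    refine (abs_add_le _ _).trans ?_
    simp only [abs_mul]
    have h3 : |r i| * (|C i j| * |c j|) ≤ ‖r‖ * (|C i j| * ‖c‖) := by
      gcongr <;> exact abs_apply_le_norm _ _
    have h4 : |c i| * (|C i j| * |r j|) ≤ ‖c‖ * (|C i j| * ‖r‖) := by
      gcongr <;> exact abs_apply_le_norm _ _
    linarith
  linarith [(abs_le.1 h2).1]

theorem norm_le_sum_abs (r : Coef p) : ‖r‖ ≤ ∑ j, |r j| := by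
  have h : r = ∑ j, r j • EuclideanSpace.single j (1 : ℝ) := by
    ext k
    simp [Finset.sum_apply, Pi.single_apply]
  calc ‖r‖ = ‖∑ j, r j • EuclideanSpace.single j (1 : ℝ)‖ := by rw [← h]
    _ ≤ ∑ j, ‖r j • EuclideanSpace.single j (1 : ℝ)‖ := norm_sum_le _ _
    _ = ∑ j, |r j| := by simp [norm_smul]

theorem tendsto_source (H : IsEstimateSeq βs γ₁ γ₂ r₀ C z w N m X e lam eta βt βh) :
    Tendsto (fun i => (m i : ℝ)) atTop atTop := by
  have hN : Tendsto (fun i => (N i : ℝ)) atTop atTop :=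
    tendsto_natCast_atTop_atTop.comp H.tendsto_size
  have hb : ∀ᶠ i in atTop, (N i : ℝ) / m i < |r₀| + 1 :=
    H.tendsto_ratio.eventually_lt_const (by linarith [le_abs_self r₀])
  refine tendsto_atTop_mono' _ ?_ (hN.atTop_mul_const (r := (|r₀| + 1)⁻¹) (by positivity))
  filter_upwards [hb, H.source_pos] with i h1 h2
  have hm : (0 : ℝ) < m i := Nat.cast_pos.2 h2
  rw [div_lt_iff₀ hm] at h1
  rw [← div_eq_mul_inv, div_le_iff₀ (by positivity)]
  linarith

/-- Convergence of the estimates at the scale `√m`, when the penalties dominate the quadratic part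
of the objective. -/
theorem tendsto_sqrt_source_smul_sub
    (H : IsEstimateSeq βs γ₁ γ₂ r₀ C z w N m X e lam eta βt βh) {A : ℕ → Fin p → ℝ}
    (hA0 : ∀ᶠ i in atTop, ∀ j, 0 ≤ A i j)
    (hA : ∀ᶠ i in atTop, ∀ j, ENNReal.ofReal (A i j) ≤
      ENNReal.ofReal (lam i) * (ENNReal.ofReal (|βt i j| ^ γ₁))⁻¹)
    {cs : ℕ → Fin p → ℝ} (hAeq : ∀ᶠ i in atTop, ∀ j, √(m i : ℝ) * βs j + cs i j = 0 ∨
      ENNReal.ofReal (A i j) = ENNReal.ofReal (lam i) * (ENNReal.ofReal (|βt i j| ^ γ₁))⁻¹)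
    {c : Coef p} (hcs : ∀ j, Tendsto (fun i => cs i j) atTop (𝓝 (c j))) {α δ : ℕ → ℝ}
    (hα : Tendsto (fun i => α i / √(N i : ℝ)) atTop atTop) (hδ : Tendsto δ atTop (𝓝 0))
    (hdom : ∀ᶠ i in atTop, ∀ j x, α i * (|x - cs i j| - δ i) ≤
      A i j * (|√(m i : ℝ) * βs j + x| - |√(m i : ℝ) * βs j + cs i j|)
        + eta i * |βt i j| ^ γ₂ * (|x - √(m i : ℝ) * (βt i j - βs j)|
          - |cs i j - √(m i : ℝ) * (βt i j - βs j)|)) :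
    Tendsto (fun i => √(m i : ℝ) • (βh i - βs)) atTop (𝓝 c) := by
  have hN : ∀ᶠ i in atTop, 0 < N i := H.tendsto_size.eventually_gt_atTop 0
  let cv : ℕ → Coef p := fun i => WithLp.toLp 2 (cs i)
  have hcv : Tendsto cv atTop (𝓝 c) :=
    ((PiLp.continuous_toLp 2 fun _ : Fin p => ℝ).tendsto c.ofLp).comp (tendsto_pi_nhds.2 hcs)
  obtain ⟨κ, hκ, hκC⟩ := exists_eventually_mul_sq_norm_le_quad H.posDef H.tendsto_gram
  have hCb : ∀ᶠ i in atTop, ∑ k, ∑ l, |((1 / N i : ℝ) • ((X i)ᵀ * X i)) k l| <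
      ∑ k, ∑ l, |C k l| + 1 := by
    have hcont : Continuous fun D : Matrix (Fin p) (Fin p) ℝ => ∑ k, ∑ l, |D k l| := by fun_prop
    exact ((hcont.tendsto C).comp H.tendsto_gram).eventually_lt_const (lt_add_one _)
  have hcb := hcv.norm.eventually_lt_const (lt_add_one _)
  have hwb := H.tendsto_score.norm.eventually_lt_const (lt_add_one _)
  have hrat : ∀ᶠ i in atTop, √((N i : ℝ) / m i) < √r₀ + 1 :=
    ((Real.continuous_sqrt.tendsto r₀).comp H.tendsto_ratio).eventually_lt_const (lt_add_one _)
  let c₁ : ℝ := ∑ k, ∑ l, |C k l| + 1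
  have hc₁ : 0 < c₁ := by positivity
  let K : ℝ := 2 * c₁ * (‖c‖ + 1) * (√r₀ + 1) + 2 * (‖w‖ + 1)
  have hK : 0 < K := by positivity
  -- With `r` the deviation from the pins, `ρ` its `ℓ¹` norm and `t = √m / √N`, the basic inequality
  -- bounds `t (α / √N) (ρ - p δ)` by `t K ρ`. Once `α / √N ≥ 2 K` this forces `ρ ≤ 2 p δ`.
  have hmain : ∀ᶠ i in atTop,
      ∑ j, |(√(m i : ℝ) • (βh i - βs) - cv i) j| ≤ 2 * (p * δ i) := by
    filter_upwards [hN, H.source_pos, hA0, hA, hAeq, hdom, hκC, hCb, hcb, hwb, hrat,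
      hα.eventually_ge_atTop (2 * K)] with i h1 h2 h3 h4 h5 h6 h7 h8 h9 h10 h11 h12
    have hn : (0 : ℝ) < N i := Nat.cast_pos.2 h1
    have hm : (0 : ℝ) < m i := Nat.cast_pos.2 h2
    set s := √(m i : ℝ) with hs
    have hspos : 0 < s := Real.sqrt_pos.2 hm
    have hnpos : 0 < √(N i : ℝ) := Real.sqrt_pos.2 hn
    set t := s / √(N i : ℝ) with ht
    have htpos : 0 < t := div_pos hspos hnpos
    -- Boundedness of `N / m` keeps `t` away from `0`, so the cross term of the quadratic form,
    -- which carries no factor `t`, can be absorbed into `t K ρ`.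
    have hone : 1 ≤ (√r₀ + 1) * t := by
      rw [Real.sqrt_div hn.le, ← hs, div_lt_iff₀ hspos] at h11
      rw [ht, mul_div_assoc', le_div_iff₀ hnpos]
      linarith
    have hsn : s / N i = t / √(N i : ℝ) := by
      rw [ht, div_div, Real.mul_self_sqrt hn.le]
    set u := s • (βh i - βs) with hu
    set r := u - cv i with hr
    set ρ := ∑ j, |r j| with hρ
    have hρ0 : 0 ≤ ρ := Finset.sum_nonneg fun _ _ => abs_nonneg _
    have hrρ : ‖r‖ ≤ ρ := norm_le_sum_abs r
    have hsn0 : 0 ≤ s / N i := by positivity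
    have hscale : ENNReal.ofReal (s * lam i / N i) =
        ENNReal.ofReal (s / N i) * ENNReal.ofReal (lam i) := by
      rw [← ENNReal.ofReal_mul hsn0, div_mul_eq_mul_div]
    have hbasic := (H.isEstimate i).rescaled_le (A := fun j => s / N i * A i j) (v := cv i) h1
      hspos (H.eta_nonneg i) (fun j => mul_nonneg hsn0 (h3 j))
      (fun j => by
        rw [ENNReal.ofReal_mul hsn0, hscale, mul_assoc]
        exact mul_le_mul_right (h4 j) _)
      (fun j => by
        refine (h5 j).imp id fun h => ?_
        rw [ENNReal.ofReal_mul hsn0, hscale, mul_assoc, h])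
    rw [← hu] at hbasic
    have hpen : s / N i * (α i * (ρ - p * δ i)) ≤
        ∑ j, (s / N i * A i j * (|s * βs j + u j| - |s * βs j|)
          + s * eta i / N i * |βt i j| ^ γ₂ * |u j - s * (βt i j - βs j)|)
        - ∑ j, (s / N i * A i j * (|s * βs j + cv i j| - |s * βs j|)
          + s * eta i / N i * |βt i j| ^ γ₂ * |cv i j - s * (βt i j - βs j)|) := by
      have h13 : s / N i * (α i * (ρ - p * δ i)) =
          ∑ j, s / N i * (α i * (|r j| - δ i)) := by
        rw [← Finset.mul_sum, ← Finset.mul_sum, Finset.sum_sub_distrib]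
        simp [hρ]
      rw [h13, ← Finset.sum_sub_distrib]
      refine Finset.sum_le_sum fun j _ => ?_
      have h14 := mul_le_mul_of_nonneg_left (h6 j (u j)) hsn0
      have h15 : r j = u j - cs i j := rfl
      have h16 : cv i j = cs i j := rfl
      rw [h15, h16]
      refine h14.trans (le_of_eq ?_)
      ring
    have hquad := quad_add_ge ((1 / N i : ℝ) • ((X i)ᵀ * X i)) (cv i) r
    rw [hr, add_sub_cancel, ← hr] at hquad
    have hr0 : 0 ≤ quad ((1 / N i : ℝ) • ((X i)ᵀ * X i)) r :=
      le_trans (by positivity) (h7 r)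
    have hlin : u.ofLp ⬝ᵥ (t • score (X i) (e i)).ofLp
        - (cv i).ofLp ⬝ᵥ (t • score (X i) (e i)).ofLp ≤ t * ((‖w‖ + 1) * ρ) := by
      rw [← sub_dotProduct, ← WithLp.ofLp_sub, ← hr]
      refine (le_abs_self _).trans ((abs_dotProduct_le _ _).trans ?_)
      rw [norm_smul, Real.norm_of_nonneg htpos.le]
      calc ‖r‖ * (t * ‖score (X i) (e i)‖) ≤ ρ * (t * (‖w‖ + 1)) := by gcongr
        _ = t * ((‖w‖ + 1) * ρ) := by ring
    have hcross : 2 * (∑ k, ∑ l, |((1 / N i : ℝ) • ((X i)ᵀ * X i)) k l|) * ‖cv i‖ * ‖r‖ ≤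
        2 * c₁ * (‖c‖ + 1) * ρ := by gcongr
    have hcross' : 2 * c₁ * (‖c‖ + 1) * ρ ≤ 2 * c₁ * (‖c‖ + 1) * ρ * ((√r₀ + 1) * t) :=
      le_mul_of_one_le_right (by positivity) hone
    have hfin : t * (α i / √(N i : ℝ) * (ρ - p * δ i)) ≤ t * (K * ρ) := by
      have h17 : t * (α i / √(N i : ℝ) * (ρ - p * δ i)) = s / N i * (α i * (ρ - p * δ i)) := by
        rw [hsn]; ring
      have h18 : t * (K * ρ) = 2 * c₁ * (‖c‖ + 1) * ρ * ((√r₀ + 1) * t)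
          + 2 * (t * ((‖w‖ + 1) * ρ)) := by
        simp only [K]; ring
      rw [h17, h18]
      linarith
    have hfin' := le_of_mul_le_mul_left hfin htpos
    have hq : 0 < α i / √(N i : ℝ) := by linarith
    have h19 : α i / √(N i : ℝ) * (ρ - p * δ i) ≤ α i / √(N i : ℝ) * (ρ / 2) := by
      refine hfin'.trans ?_
      rw [mul_div_assoc', mul_div_right_comm]
      gcongr
      linarith
    have h20 := le_of_mul_le_mul_left h19 hq
    linarith
  have hdiff : Tendsto (fun i => √(m i : ℝ) • (βh i - βs) - cv i) atTop (𝓝 0) := by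
    refine squeeze_zero_norm' ?_ (by simpa using (hδ.const_mul (p : ℝ)).const_mul 2)
    filter_upwards [hmain] with i hi
    exact (norm_le_sum_abs _).trans hi
  simpa using hdiff.add hcv

end Generic

end IsEstimateSeq

namespace IsEstimateSeq

variable {p : ℕ} {βs : Coef p} {γ₁ γ₂ r₀ : ℝ} {C : Matrix (Fin p) (Fin p) ℝ} {z w : Coef p}
  {N m : ℕ → ℕ} {X : (i : ℕ) → Matrix (Fin (N i)) (Fin p) ℝ} {e : (i : ℕ) → Fin (N i) → ℝ}
  {lam eta : ℕ → ℝ} {βt βh : ℕ → Coef p}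

/-! ### Rates of the initial estimate and of the weights -/

section Rates

theorem tendsto_sqrt_size
    (H : IsEstimateSeq βs γ₁ γ₂ r₀ C z w N m X e lam eta βt βh) :
    Tendsto (fun i => √(N i : ℝ)) atTop atTop :=
  Real.tendsto_sqrt_atTop.comp (tendsto_natCast_atTop_atTop.comp H.tendsto_size)

theorem tendsto_sqrt_source_rpow
    (H : IsEstimateSeq βs γ₁ γ₂ r₀ C z w N m X e lam eta βt βh) {γ : ℝ} (hγ : 0 < γ) :
    Tendsto (fun i => √((m i : ℝ) ^ γ)) atTop atTop :=
  Real.tendsto_sqrt_atTop.comp ((tendsto_rpow_atTop hγ).comp H.tendsto_source)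

theorem eventually_one_le_sqrt_source_rpow
    (H : IsEstimateSeq βs γ₁ γ₂ r₀ C z w N m X e lam eta βt βh) {γ : ℝ} (hγ : 0 ≤ γ) :
    ∀ᶠ i in atTop, 1 ≤ √((m i : ℝ) ^ γ) := by
  filter_upwards [H.tendsto_source.eventually_ge_atTop 1] with i hi
  rw [Real.one_le_sqrt]
  exact Real.one_le_rpow hi hγ

theorem tendsto_initial_apply
    (H : IsEstimateSeq βs γ₁ γ₂ r₀ C z w N m X e lam eta βt βh) (j : Fin p) :
    Tendsto (fun i => √(m i : ℝ) * (βt i j - βs j)) atTop (𝓝 (z j)) :=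
  ((by fun_prop : Continuous fun x : Coef p => x j).tendsto z).comp H.tendsto_initial

theorem tendsto_initial_coef
    (H : IsEstimateSeq βs γ₁ γ₂ r₀ C z w N m X e lam eta βt βh)
    (j : Fin p) : Tendsto (fun i => βt i j) atTop (𝓝 (βs j)) := by
  have h1 : Tendsto (fun i => √(m i : ℝ)) atTop atTop :=
    Real.tendsto_sqrt_atTop.comp H.tendsto_source
  have h2 := ((H.tendsto_initial_apply j).div_atTop h1).add_const (βs j)
  rw [zero_add] at h2
  refine h2.congr' ?_
  filter_upwards [h1.eventually_gt_atTop 0] with i hi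
  rw [mul_div_cancel_left₀ _ hi.ne', sub_add_cancel]

theorem tendsto_abs_initial_rpow
    (H : IsEstimateSeq βs γ₁ γ₂ r₀ C z w N m X e lam eta βt βh) {γ : ℝ} (hγ : 0 ≤ γ) (j : Fin p) :
    Tendsto (fun i => |βt i j| ^ γ) atTop (𝓝 (|βs j| ^ γ)) :=
  (H.tendsto_initial_coef j).abs.rpow_const (Or.inr hγ)

/-- At an inactive coordinate the initial estimate is its own error, of order `1 / √m`. This is the
origin of the powers of `m` in the rate conditions. -/
theorem abs_initial_rpow_eq
    (H : IsEstimateSeq βs γ₁ γ₂ r₀ C z w N m X e lam eta βt βh)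
    (γ : ℝ) {j : Fin p} (hj : βs j = 0) :
    ∀ᶠ i in atTop, |βt i j| ^ γ = |√(m i : ℝ) * (βt i j - βs j)| ^ γ / √((m i : ℝ) ^ γ) := by
  filter_upwards [H.source_pos] with i hi
  have hm : (0 : ℝ) < m i := Nat.cast_pos.2 hi
  have h1 : √((m i : ℝ) ^ γ) = √(m i : ℝ) ^ γ := by
    rw [Real.sqrt_eq_rpow, Real.sqrt_eq_rpow, ← Real.rpow_mul hm.le, ← Real.rpow_mul hm.le,
      mul_comm]
  have h2 : 0 < √(m i : ℝ) ^ γ := Real.rpow_pos_of_pos (Real.sqrt_pos.2 hm) _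
  rw [hj, sub_zero, abs_mul, abs_of_nonneg (Real.sqrt_nonneg _),
    Real.mul_rpow (Real.sqrt_nonneg _) (abs_nonneg _), h1, mul_div_cancel_left₀ _ h2.ne']

theorem tendsto_abs_scaled_rpow
    (H : IsEstimateSeq βs γ₁ γ₂ r₀ C z w N m X e lam eta βt βh)
    {γ : ℝ} {j : Fin p} (h : z j ≠ 0 ∨ 0 ≤ γ) :
    Tendsto (fun i => |√(m i : ℝ) * (βt i j - βs j)| ^ γ) atTop (𝓝 (|z j| ^ γ)) :=
  (H.tendsto_initial_apply j).abs.rpow_const (h.imp abs_ne_zero.2 id)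

theorem eventually_initial_rpow_pos
    (H : IsEstimateSeq βs γ₁ γ₂ r₀ C z w N m X e lam eta βt βh)
    {j : Fin p} (h : βs j ≠ 0 ∨ z j ≠ 0 ∨ γ₁ = 0) :
    ∀ᶠ i in atTop, 0 < |βt i j| ^ γ₁ := by
  rcases h with h | h | h
  · filter_upwards [(H.tendsto_initial_coef j).eventually_ne h] with i hi
    exact Real.rpow_pos_of_pos (abs_pos.2 hi) _
  · by_cases hj : βs j = 0
    · filter_upwards [(H.tendsto_initial_apply j).eventually_ne h] with i hi
      have : βt i j ≠ 0 := by
        rintro h0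
        simp [h0, hj] at hi
      exact Real.rpow_pos_of_pos (abs_pos.2 this) _
    · filter_upwards [(H.tendsto_initial_coef j).eventually_ne hj] with i hi
      exact Real.rpow_pos_of_pos (abs_pos.2 hi) _
  · simp [h]

theorem tendsto_sqrt_size_mul
    (H : IsEstimateSeq βs γ₁ γ₂ r₀ C z w N m X e lam eta βt βh) (j : Fin p) :
    Tendsto (fun i => √(N i : ℝ) * (βt i j - βs j)) atTop (𝓝 (√r₀ * z j)) := by
  refine (((Real.continuous_sqrt.tendsto r₀).comp H.tendsto_ratio).mul
    (H.tendsto_initial_apply j)).congr' ?_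
  filter_upwards [H.source_pos] with i hi
  have hm : 0 < √(m i : ℝ) := Real.sqrt_pos.2 (Nat.cast_pos.2 hi)
  rw [Function.comp_apply, Real.sqrt_div (Nat.cast_nonneg _), ← mul_assoc,
    div_mul_cancel₀ _ hm.ne']

theorem sqrt_size_mul_div
    (H : IsEstimateSeq βs γ₁ γ₂ r₀ C z w N m X e lam eta βt βh) (a : ℕ → ℝ) :
    ∀ᶠ i in atTop, √(N i : ℝ) * a i / N i = a i / √(N i : ℝ) := by
  filter_upwards [H.tendsto_size.eventually_gt_atTop 0] with i hi
  have hn : (0 : ℝ) < N i := Nat.cast_pos.2 hi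
  have h1 : 0 < √(N i : ℝ) := Real.sqrt_pos.2 hn
  rw [div_eq_div_iff hn.ne' h1.ne']
  calc √(N i : ℝ) * a i * √(N i : ℝ) = a i * (√(N i : ℝ) * √(N i : ℝ)) := by ring
    _ = a i * N i := by rw [Real.mul_self_sqrt hn.le]

theorem tendsto_sqrt_size_div_self
    (H : IsEstimateSeq βs γ₁ γ₂ r₀ C z w N m X e lam eta βt βh) :
    Tendsto (fun i => √(N i : ℝ) / √(N i : ℝ)) atTop (𝓝 1) := by
  refine tendsto_const_nhds.congr' ?_
  filter_upwards [H.tendsto_sqrt_size.eventually_gt_atTop 0] with i hi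
  rw [div_self hi.ne']

/-- The rate of `λ / √n` implied by the rate of `√(m ^ γ₁ / n) λ`. -/
theorem tendsto_lam_div_sqrt
    (H : IsEstimateSeq βs γ₁ γ₂ r₀ C z w N m X e lam eta βt βh) {lam₁ : ℝ}
    (h : Tendsto (fun i => √((m i : ℝ) ^ γ₁ / N i) * lam i) atTop (𝓝 lam₁)) :
    Tendsto (fun i => lam i / √(N i : ℝ)) atTop (𝓝 (if γ₁ = 0 then lam₁ else 0)) := by
  have hrw : ∀ i, √((m i : ℝ) ^ γ₁ / N i) * lam i = √((m i : ℝ) ^ γ₁) * (lam i / √(N i : ℝ)) := by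
    intro i
    rw [Real.sqrt_div (Real.rpow_nonneg (Nat.cast_nonneg _) _)]
    ring
  simp only [hrw] at h
  split_ifs with hγ
  · simpa [hγ] using h
  · have hpos : 0 < γ₁ := lt_of_le_of_ne H.gamma₁_nonneg (Ne.symm hγ)
    have h1 := H.tendsto_sqrt_source_rpow hpos
    refine (h.div_atTop h1).congr' ?_
    filter_upwards [h1.eventually_gt_atTop 0] with i hi
    rw [mul_div_cancel_left₀ _ hi.ne']

/-- A lower bound for the adaptive weights of inactive coordinates. -/
theorem eventually_weight_le
    (H : IsEstimateSeq βs γ₁ γ₂ r₀ C z w N m X e lam eta βt βh)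
    {l : ℕ → ℝ} (hl : ∀ᶠ i in atTop, 0 < l i) {j : Fin p}
    (hj : βs j = 0) :
    ∀ᶠ i in atTop, ENNReal.ofReal (l i * √((m i : ℝ) ^ γ₁) / (‖z‖ + 1) ^ γ₁) ≤
      ENNReal.ofReal (l i) * (ENNReal.ofReal (|βt i j| ^ γ₁))⁻¹ := by
  have hz : |z j| < ‖z‖ + 1 := (abs_apply_le_norm z j).trans_lt (lt_add_one _)
  filter_upwards [hl, H.abs_initial_rpow_eq γ₁ hj, H.source_pos,
    (H.tendsto_initial_apply j).abs.eventually_lt_const hz] with i h1 h2 h3 h4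
  refine ofReal_le_weight (by positivity) ?_ (Or.inr h1)
  have hm : (0 : ℝ) < m i := Nat.cast_pos.2 h3
  have h5 : 0 < √((m i : ℝ) ^ γ₁) := Real.sqrt_pos.2 (Real.rpow_pos_of_pos hm _)
  have h6 : |√(m i : ℝ) * (βt i j - βs j)| ^ γ₁ ≤ (‖z‖ + 1) ^ γ₁ :=
    Real.rpow_le_rpow (abs_nonneg _) h4.le H.gamma₁_nonneg
  have h7 : 0 < (‖z‖ + 1) ^ γ₁ := by positivity
  rw [h2, div_mul_div_comm, div_le_iff₀ (by positivity)]
  calc l i * √((m i : ℝ) ^ γ₁) * |√(m i : ℝ) * (βt i j - βs j)| ^ γ₁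
      ≤ l i * √((m i : ℝ) ^ γ₁) * (‖z‖ + 1) ^ γ₁ := by gcongr
    _ = l i * ((‖z‖ + 1) ^ γ₁ * √((m i : ℝ) ^ γ₁)) := by ring

end Rates

/-! ### Limits at the scale of the root of the sample size -/

section SqrtSize

/-- The adaptive weight of an inactive coordinate at the scale `√n`. -/
theorem tendsto_weight_inactive
    (H : IsEstimateSeq βs γ₁ γ₂ r₀ C z w N m X e lam eta βt βh) {lam₁ : ℝ}
    (h : Tendsto (fun i => √((m i : ℝ) ^ γ₁ / N i) * lam i) atTop (𝓝 lam₁)) {j : Fin p}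
    (hj : βs j = 0) (hz : 0 < γ₁ → z j ≠ 0) :
    Tendsto (fun i => √(N i : ℝ) * lam i / N i / |βt i j| ^ γ₁) atTop
      (𝓝 (lam₁ / |z j| ^ γ₁)) := by
  have hne : |z j| ^ γ₁ ≠ 0 := by
    rcases H.gamma₁_nonneg.eq_or_lt with h0 | h0
    · simp [← h0]
    · exact (Real.rpow_pos_of_pos (abs_pos.2 (hz h0)) _).ne'
  refine (h.div (H.tendsto_abs_scaled_rpow (Or.inr H.gamma₁_nonneg)) hne).congr' ?_
  filter_upwards [H.sqrt_size_mul_div lam, H.abs_initial_rpow_eq γ₁ hj] with i h1 h2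
  rw [Pi.div_apply, h1, h2, Real.sqrt_div (Real.rpow_nonneg (Nat.cast_nonneg _) _)]
  simp only [div_eq_mul_inv, mul_inv, inv_inv]
  ring

/-- The adaptive weight of an active coordinate at the scale `√n`. -/
theorem tendsto_weight_active
    (H : IsEstimateSeq βs γ₁ γ₂ r₀ C z w N m X e lam eta βt βh)
    {l : ℝ} (h : Tendsto (fun i => lam i / √(N i : ℝ)) atTop (𝓝 l))
    {j : Fin p} (hj : βs j ≠ 0) :
    Tendsto (fun i => √(N i : ℝ) * lam i / N i / |βt i j| ^ γ₁) atTop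
      (𝓝 (l / |βs j| ^ γ₁)) := by
  have hne : |βs j| ^ γ₁ ≠ 0 := (Real.rpow_pos_of_pos (abs_pos.2 hj) _).ne'
  refine (h.div (H.tendsto_abs_initial_rpow H.gamma₁_nonneg j) hne).congr' ?_
  filter_upwards [H.sqrt_size_mul_div lam] with i h1
  rw [Pi.div_apply, h1]

theorem tendsto_transfer_weight
    (H : IsEstimateSeq βs γ₁ γ₂ r₀ C z w N m X e lam eta βt βh) {eta₀ : ℝ}
    (h : Tendsto (fun i => eta i / √(N i : ℝ)) atTop (𝓝 eta₀)) (j : Fin p) :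
    Tendsto (fun i => √(N i : ℝ) * eta i / N i * |βt i j| ^ γ₂) atTop
      (𝓝 (eta₀ * |βs j| ^ γ₂)) := by
  refine (h.mul (H.tendsto_abs_initial_rpow H.gamma₂_nonneg j)).congr' ?_
  filter_upwards [H.sqrt_size_mul_div eta] with i h1
  rw [h1]

theorem tendsto_transfer_weight_inactive
    (H : IsEstimateSeq βs γ₁ γ₂ r₀ C z w N m X e lam eta βt βh) {eta₁ : ℝ}
    (h : Tendsto (fun i => eta i / √(N i * (m i : ℝ) ^ γ₂)) atTop (𝓝 eta₁)) {j : Fin p}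
    (hj : βs j = 0) :
    Tendsto (fun i => √(N i : ℝ) * eta i / N i * |βt i j| ^ γ₂) atTop
      (𝓝 (eta₁ * |z j| ^ γ₂)) := by
  refine (h.mul (H.tendsto_abs_scaled_rpow (Or.inr H.gamma₂_nonneg))).congr' ?_
  filter_upwards [H.sqrt_size_mul_div eta, H.abs_initial_rpow_eq γ₂ hj] with i h1 h2
  rw [h1, h2, Real.sqrt_mul (Nat.cast_nonneg _)]
  simp only [div_eq_mul_inv, mul_inv]
  ring

theorem eventually_weight_pos
    (H : IsEstimateSeq βs γ₁ γ₂ r₀ C z w N m X e lam eta βt βh)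
    (hz : 0 < γ₁ → ∀ j, βs j = 0 → z j ≠ 0) :
    ∀ᶠ i in atTop, ∀ j, 0 < |βt i j| ^ γ₁ := by
  refine eventually_all.2 fun j => H.eventually_initial_rpow_pos ?_
  by_cases hj : βs j = 0
  · rcases H.gamma₁_nonneg.eq_or_lt with h0 | h0
    · exact Or.inr (Or.inr h0.symm)
    · exact Or.inr (Or.inl (hz h0 j hj))
  · exact Or.inl hj

/-- Neither penalty dominates the quadratic part: all coordinates are free. -/
theorem tendsto_of_free
    (H : IsEstimateSeq βs γ₁ γ₂ r₀ C z w N m X e lam eta βt βh)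
    {lam₁ eta₀ : ℝ} (hlam₁ : γ₁ = 0 → lam₁ = 0)
    (hz : 0 < γ₁ → ∀ j, βs j = 0 → z j ≠ 0)
    (hlam : Tendsto (fun i => √((m i : ℝ) ^ γ₁ / N i) * lam i) atTop (𝓝 lam₁))
    (heta : Tendsto (fun i => eta i / √(N i : ℝ)) atTop (𝓝 eta₀)) {u₀ : Coef p}
    (hu₀ : IsArgmin {v | ∀ j ∉ Finset.univ, v j = 0}
      (fun v => quad C v - 2 * (v.ofLp ⬝ᵥ w.ofLp)
        + ∑ j, limitPenalty (βs j) (if βs j = 0 then lam₁ / |z j| ^ γ₁ else 0)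
          (eta₀ * |βs j| ^ γ₂) (√r₀ * z j) (v j)) u₀) :
    Tendsto (fun i => √(N i : ℝ) • (βh i - βs)) atTop (𝓝 u₀) := by
  have hpos := H.eventually_weight_pos hz
  have heq : ∀ᶠ i in atTop, ∀ j, ENNReal.ofReal (√(N i : ℝ) * lam i / N i / |βt i j| ^ γ₁) =
      ENNReal.ofReal (√(N i : ℝ) * lam i / N i) * (ENNReal.ofReal (|βt i j| ^ γ₁))⁻¹ := by
    filter_upwards [hpos] with i hi j
    exact ofReal_div_eq_weight (hi j)
  refine H.tendsto_smul_sub (T := Finset.univ) (τ := 1) H.tendsto_sqrt_size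
    H.tendsto_sqrt_size_div_self
    (A := fun i j => √(N i : ℝ) * lam i / N i / |βt i j| ^ γ₁)
    (A₀ := fun j => if βs j = 0 then lam₁ / |z j| ^ γ₁ else 0)
    (B₀ := fun j => eta₀ * |βs j| ^ γ₂) (d₀ := fun j => √r₀ * z j) (c := fun _ => 0)
    (Eventually.of_forall fun i j => ?_) ?_ ?_ (fun j _ => ?_)
    (fun j _ => H.tendsto_transfer_weight heta j) (fun j _ => H.tendsto_sqrt_size_mul j)
    (fun j hj => absurd (Finset.mem_univ j) hj) (fun j hj => absurd (Finset.mem_univ j) hj)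
    (by simpa only [one_smul] using hu₀)
  · have := H.lam_nonneg i
    positivity
  · filter_upwards [heq] with i hi j using (hi j).le
  · filter_upwards [heq] with i hi j _ using hi j
  · by_cases hj : βs j = 0
    · simp only [hj, if_true]
      exact H.tendsto_weight_inactive hlam hj fun h => hz h j hj
    · simp only [hj, if_false]
      have h1 := H.tendsto_lam_div_sqrt hlam
      rw [show (if γ₁ = 0 then lam₁ else 0) = 0 by split_ifs with h <;> simp [hlam₁, h]] at h1
      simpa using H.tendsto_weight_active h1 hj

/-- The transfer penalty dominates at the active coordinates. -/
theorem tendsto_of_active_pinned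
    (H : IsEstimateSeq βs γ₁ γ₂ r₀ C z w N m X e lam eta βt βh)
    {lam₁ eta₁ : ℝ} (hz : 0 < γ₁ → ∀ j, βs j = 0 → z j ≠ 0)
    (hlam : Tendsto (fun i => √((m i : ℝ) ^ γ₁ / N i) * lam i) atTop (𝓝 lam₁))
    (heta : Tendsto (fun i => eta i / √(N i : ℝ)) atTop atTop)
    (heta₁ : Tendsto (fun i => eta i / √(N i * (m i : ℝ) ^ γ₂)) atTop (𝓝 eta₁)) {u₀ : Coef p}
    (hu₀ : IsArgmin {v | ∀ j ∉ (active βs)ᶜ, v j = √r₀ * z j}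
      (fun v => quad C v - 2 * (v.ofLp ⬝ᵥ w.ofLp)
        + ∑ j ∈ (active βs)ᶜ, limitPenalty (βs j) (lam₁ / |z j| ^ γ₁)
          (eta₁ * |z j| ^ γ₂) (√r₀ * z j) (v j)) u₀) :
    Tendsto (fun i => √(N i : ℝ) • (βh i - βs)) atTop (𝓝 u₀) := by
  have hpos := H.eventually_weight_pos hz
  have heq : ∀ᶠ i in atTop, ∀ j, ENNReal.ofReal (√(N i : ℝ) * lam i / N i / |βt i j| ^ γ₁) =
      ENNReal.ofReal (√(N i : ℝ) * lam i / N i) * (ENNReal.ofReal (|βt i j| ^ γ₁))⁻¹ := by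
    filter_upwards [hpos] with i hi j
    exact ofReal_div_eq_weight (hi j)
  have hmem : ∀ j, j ∈ (active βs)ᶜ ↔ βs j = 0 := by simp [active]
  refine H.tendsto_smul_sub (T := (active βs)ᶜ) (τ := 1) H.tendsto_sqrt_size
    H.tendsto_sqrt_size_div_self
    (A := fun i j => √(N i : ℝ) * lam i / N i / |βt i j| ^ γ₁)
    (A₀ := fun j => lam₁ / |z j| ^ γ₁)
    (B₀ := fun j => eta₁ * |z j| ^ γ₂) (d₀ := fun j => √r₀ * z j) (c := fun j => √r₀ * z j)
    (Eventually.of_forall fun i j => ?_) ?_ ?_ (fun j hj => ?_)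
    (fun j hj => H.tendsto_transfer_weight_inactive heta₁ ((hmem j).1 hj))
    (fun j _ => H.tendsto_sqrt_size_mul j)
    (fun j hj h0 => absurd ((hmem j).2 h0) hj)
    (fun j hj h0 => ⟨H.tendsto_sqrt_size_mul j, ?_⟩)
    (by simpa only [one_smul] using hu₀)
  · have := H.lam_nonneg i
    positivity
  · filter_upwards [heq] with i hi j using (hi j).le
  · filter_upwards [heq] with i hi j _ using hi j
  · have hj := (hmem j).1 hj
    exact H.tendsto_weight_inactive hlam hj fun h => hz h j hj
  · have h1 := H.tendsto_weight_active (H.tendsto_lam_div_sqrt hlam) h0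
    have h2 : Tendsto (fun i => eta i / √(N i : ℝ) * |βt i j| ^ γ₂) atTop atTop :=
      heta.atTop_mul_pos (Real.rpow_pos_of_pos (abs_pos.2 h0) _)
        (H.tendsto_abs_initial_rpow H.gamma₂_nonneg j)
    have h3 : Tendsto (fun i => √(N i : ℝ) * eta i / N i * |βt i j| ^ γ₂) atTop atTop := by
      refine h2.congr' ?_
      filter_upwards [H.sqrt_size_mul_div eta] with i h1
      rw [h1]
    simpa only [sub_eq_add_neg] using h3.atTop_add h1.neg

/-- The adaptive penalty dominates at the inactive coordinates, at the scale `√n`. -/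
theorem tendsto_of_inactive_pinned
    (H : IsEstimateSeq βs γ₁ γ₂ r₀ C z w N m X e lam eta βt βh) {lam₀ eta₀ : ℝ}
    (hlam : Tendsto (fun i => √((m i : ℝ) ^ γ₁ / N i) * lam i) atTop atTop)
    (hlam₀ : Tendsto (fun i => lam i / √(N i : ℝ)) atTop (𝓝 lam₀))
    (heta : Tendsto (fun i => eta i / √(N i : ℝ)) atTop (𝓝 eta₀)) {u₀ : Coef p}
    (hu₀ : IsArgmin {v | ∀ j ∉ active βs, v j = 0}
      (fun v => quad C v - 2 * (v.ofLp ⬝ᵥ w.ofLp)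
        + ∑ j ∈ active βs, limitPenalty (βs j) (lam₀ / |βs j| ^ γ₁)
          (eta₀ * |βs j| ^ γ₂) (√r₀ * z j) (v j)) u₀) :
    Tendsto (fun i => √(N i : ℝ) • (βh i - βs)) atTop (𝓝 u₀) := by
  have hmem : ∀ j, j ∈ active βs ↔ βs j ≠ 0 := by simp [active]
  have hl : ∀ᶠ i in atTop, 0 < √(N i : ℝ) * lam i / N i := by
    filter_upwards [hlam.eventually_gt_atTop 0, H.tendsto_size.eventually_gt_atTop 0] with i h1 h2
    have hn : (0 : ℝ) < N i := Nat.cast_pos.2 h2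
    have : 0 < lam i := pos_of_mul_pos_right h1 (Real.sqrt_nonneg _)
    positivity
  have heq : ∀ᶠ i in atTop, ∀ j, βs j ≠ 0 →
      ENNReal.ofReal (√(N i : ℝ) * lam i / N i / |βt i j| ^ γ₁) =
      ENNReal.ofReal (√(N i : ℝ) * lam i / N i) * (ENNReal.ofReal (|βt i j| ^ γ₁))⁻¹ := by
    refine eventually_all.2 fun j => ?_
    by_cases hj : βs j = 0
    · exact Eventually.of_forall fun _ h => absurd hj h
    filter_upwards [H.eventually_initial_rpow_pos (Or.inl hj)] with i hi _
    exact ofReal_div_eq_weight hi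
  have hle : ∀ᶠ i in atTop, ∀ j, βs j = 0 →
      ENNReal.ofReal (√(N i : ℝ) * lam i / N i * √((m i : ℝ) ^ γ₁) / (‖z‖ + 1) ^ γ₁) ≤
      ENNReal.ofReal (√(N i : ℝ) * lam i / N i) * (ENNReal.ofReal (|βt i j| ^ γ₁))⁻¹ := by
    refine eventually_all.2 fun j => ?_
    by_cases hj : βs j = 0
    · filter_upwards [H.eventually_weight_le hl hj] with i hi _ using hi
    · exact Eventually.of_forall fun _ h => absurd h hj
  refine H.tendsto_smul_sub (T := active βs) (τ := 1) H.tendsto_sqrt_size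
    H.tendsto_sqrt_size_div_self
    -- At inactive coordinates the competitor is `0`, so the lower bound with `‖z‖ + 1` in place of
    -- the scaled initial error can replace the true weight. It diverges even where `z` vanishes.
    (A := fun i j => if βs j = 0 then
      √(N i : ℝ) * lam i / N i * √((m i : ℝ) ^ γ₁) / (‖z‖ + 1) ^ γ₁
      else √(N i : ℝ) * lam i / N i / |βt i j| ^ γ₁)
    (A₀ := fun j => lam₀ / |βs j| ^ γ₁)
    (B₀ := fun j => eta₀ * |βs j| ^ γ₂) (d₀ := fun j => √r₀ * z j) (c := fun _ => 0)
    (Eventually.of_forall fun i j => ?_) ?_ ?_ (fun j hj => ?_)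
    (fun j _ => H.tendsto_transfer_weight heta j)
    (fun j _ => H.tendsto_sqrt_size_mul j)
    (fun j hj h0 => ⟨rfl, ?_⟩)
    (fun j hj h0 => absurd ((hmem j).2 h0) hj)
    (by simpa only [one_smul] using hu₀)
  · have := H.lam_nonneg i
    split_ifs <;> positivity
  · filter_upwards [heq, hle] with i h1 h2 j
    split_ifs with hj
    · exact h2 j hj
    · exact (h1 j hj).le
  · filter_upwards [heq] with i h1 j hj
    have hj : βs j ≠ 0 := hj.elim (hmem j).1 id
    simp only [hj, if_false]
    exact h1 j hj
  · have hj := (hmem j).1 hj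
    simp only [hj, if_false]
    exact H.tendsto_weight_active hlam₀ hj
  · simp only [h0, if_true]
    have h1 : Tendsto (fun i => √(N i : ℝ) * lam i / N i * √((m i : ℝ) ^ γ₁) / (‖z‖ + 1) ^ γ₁)
        atTop atTop := by
      have h2 : 0 < (‖z‖ + 1) ^ γ₁ := by positivity
      refine (hlam.atTop_div_const h2).congr' ?_
      filter_upwards [H.sqrt_size_mul_div lam] with i h3
      rw [h3, Real.sqrt_div (Real.rpow_nonneg (Nat.cast_nonneg _) _)]
      ring
    simpa only [sub_eq_add_neg] using h1.atTop_add (H.tendsto_transfer_weight heta j).neg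

end SqrtSize

/-! ### Limits at the scale set by the adaptive penalty -/

section LargePenalty

/-- The adaptive penalty dominates, at the scale `n / λ`. -/
theorem tendsto_of_lam_dominant
    (H : IsEstimateSeq βs γ₁ γ₂ r₀ C z w N m X e lam eta βt βh) (hγ₁ : 0 < γ₁)
    (hlam : Tendsto (fun i => lam i / √(N i : ℝ)) atTop atTop)
    (hlam₀ : Tendsto (fun i => lam i / N i) atTop (𝓝 0))
    (heta : Tendsto (fun i => eta i / lam i) atTop (𝓝 0)) {u₀ : Coef p}
    (hu₀ : IsArgmin {v | ∀ j ∉ active βs, v j = 0}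
      (fun v => quad C v - 2 * (v.ofLp ⬝ᵥ (0 : Coef p).ofLp)
        + ∑ j ∈ active βs, limitPenalty (βs j) (1 / |βs j| ^ γ₁) 0 0 (v j)) u₀) :
    Tendsto (fun i => ((N i : ℝ) / lam i) • (βh i - βs)) atTop (𝓝 u₀) := by
  have hmem : ∀ j, j ∈ active βs ↔ βs j ≠ 0 := by simp [active]
  have hNpos : ∀ᶠ i in atTop, (0 : ℝ) < N i := by
    filter_upwards [H.tendsto_size.eventually_gt_atTop 0] with i hi using Nat.cast_pos.2 hi
  have hlpos : ∀ᶠ i in atTop, 0 < lam i := by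
    filter_upwards [hlam.eventually_gt_atTop 0] with i hi
    exact (div_pos_iff_of_pos_right (lt_of_le_of_ne (Real.sqrt_nonneg _) (by
      rintro h
      simp [← h] at hi))).1 hi
  have hs : Tendsto (fun i => (N i : ℝ) / lam i) atTop atTop := by
    have h1 : Tendsto (fun i => lam i / N i) atTop (𝓝[>] 0) := by
      refine tendsto_nhdsWithin_iff.2 ⟨hlam₀, ?_⟩
      filter_upwards [hNpos, hlpos] with i h1 h2 using div_pos h2 h1
    refine h1.inv_tendsto_nhdsGT_zero.congr fun i => ?_
    rw [Pi.inv_apply, inv_div]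
  have hone : ∀ᶠ i in atTop, (N i : ℝ) / lam i * lam i / N i = 1 := by
    filter_upwards [hNpos, hlpos] with i h1 h2
    field_simp
  -- At this scale the noise enters with factor `√N / λ`, which tends to `0`; hence the
  -- deterministic limit.
  have hτ : Tendsto (fun i => (N i : ℝ) / lam i / √(N i : ℝ)) atTop (𝓝 0) := by
    refine hlam.inv_tendsto_atTop.congr fun i => ?_
    rw [Pi.inv_apply, inv_div, div_right_comm, Real.div_sqrt]
  have hetaw : ∀ j, Tendsto (fun i => (N i : ℝ) / lam i * eta i / N i * |βt i j| ^ γ₂) atTop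
      (𝓝 0) := by
    intro j
    have h1 := heta.mul (H.tendsto_abs_initial_rpow H.gamma₂_nonneg j)
    rw [zero_mul] at h1
    refine h1.congr' ?_
    filter_upwards [hNpos] with i h1
    field_simp
  have hd : ∀ j, Tendsto (fun i => (N i : ℝ) / lam i * (βt i j - βs j)) atTop (𝓝 0) := by
    intro j
    have h1 := hτ.mul (H.tendsto_sqrt_size_mul j)
    rw [zero_mul] at h1
    refine h1.congr' ?_
    filter_upwards [H.tendsto_sqrt_size.eventually_gt_atTop 0] with i h1
    rw [← mul_assoc, div_mul_cancel₀ _ h1.ne']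
  have heq : ∀ᶠ i in atTop, ∀ j, βs j ≠ 0 → ENNReal.ofReal (1 / |βt i j| ^ γ₁) =
      ENNReal.ofReal ((N i : ℝ) / lam i * lam i / N i) * (ENNReal.ofReal (|βt i j| ^ γ₁))⁻¹ := by
    refine eventually_all.2 fun j => ?_
    by_cases hj : βs j = 0
    · exact Eventually.of_forall fun _ h => absurd hj h
    filter_upwards [H.eventually_initial_rpow_pos (Or.inl hj), hone] with i hi h1 _
    rw [h1]
    exact ofReal_div_eq_weight hi
  have hle : ∀ᶠ i in atTop, ∀ j, βs j = 0 →
      ENNReal.ofReal (√((m i : ℝ) ^ γ₁) / (‖z‖ + 1) ^ γ₁) ≤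
      ENNReal.ofReal ((N i : ℝ) / lam i * lam i / N i) * (ENNReal.ofReal (|βt i j| ^ γ₁))⁻¹ := by
    refine eventually_all.2 fun j => ?_
    by_cases hj : βs j = 0
    · filter_upwards [H.eventually_weight_le (l := fun _ => 1)
        (Eventually.of_forall fun _ => one_pos) hj, hone] with i hi h1 _
      rw [h1]
      simpa only [one_mul] using hi
    · exact Eventually.of_forall fun _ h => absurd h hj
  refine H.tendsto_smul_sub (T := active βs) (τ := 0) hs hτ
    (A := fun i j => if βs j = 0 then √((m i : ℝ) ^ γ₁) / (‖z‖ + 1) ^ γ₁ else 1 / |βt i j| ^ γ₁)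
    (A₀ := fun j => 1 / |βs j| ^ γ₁) (B₀ := fun _ => 0) (d₀ := fun _ => 0) (c := fun _ => 0)
    (Eventually.of_forall fun i j => ?_) ?_ ?_ (fun j hj => ?_)
    (fun j _ => hetaw j) (fun j _ => hd j) (fun j hj h0 => ⟨rfl, ?_⟩)
    (fun j hj h0 => absurd ((hmem j).2 h0) hj)
    (by simpa only [zero_smul] using hu₀)
  · split_ifs <;> positivity
  · filter_upwards [heq, hle] with i h1 h2 j
    split_ifs with hj
    · exact h2 j hj
    · exact (h1 j hj).le
  · filter_upwards [heq] with i h1 j hj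
    have hj : βs j ≠ 0 := hj.elim (hmem j).1 id
    simp only [hj, if_false]
    exact h1 j hj
  · have hj := (hmem j).1 hj
    simp only [hj, if_false]
    exact tendsto_const_nhds.div (H.tendsto_abs_initial_rpow H.gamma₁_nonneg j)
      (Real.rpow_pos_of_pos (abs_pos.2 hj) _).ne'
  · simp only [h0, if_true]
    have h1 : 0 < (‖z‖ + 1) ^ γ₁ := by positivity
    simpa only [sub_eq_add_neg] using
      ((H.tendsto_sqrt_source_rpow hγ₁).atTop_div_const h1).atTop_add (hetaw j).neg

end LargePenalty

end IsEstimateSeq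

namespace IsEstimateSeq

variable {p : ℕ} {βs : Coef p} {γ₁ γ₂ r₀ : ℝ} {C : Matrix (Fin p) (Fin p) ℝ} {z w : Coef p}
  {N m : ℕ → ℕ} {X : (i : ℕ) → Matrix (Fin (N i)) (Fin p) ℝ} {e : (i : ℕ) → Fin (N i) → ℝ}
  {lam eta : ℕ → ℝ} {βt βh : ℕ → Coef p}

/-! ### Limits at the scale of the root of the source size -/

section SqrtSource

theorem mul_abs_sub_le_of_initial {A B b d x α : ℝ} (hA : 0 ≤ A) (h : α ≤ B - A) :
    α * |x - d| ≤ A * (|b + x| - |b + d|) + B * (|x - d| - |d - d|) := by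
  have h1 := abs_sub_abs_le_abs_sub (b + d) (b + x)
  rw [add_sub_add_left_eq_sub, abs_sub_comm d x] at h1
  rw [sub_self, abs_zero, sub_zero]
  nlinarith [mul_le_mul_of_nonneg_left h1 hA, mul_le_mul_of_nonneg_right h (abs_nonneg (x - d))]

theorem mul_abs_le_of_zero {A B d x α : ℝ} (hB : 0 ≤ B) (h : α ≤ A - B) :
    α * |x - 0| ≤ A * (|0 + x| - |0 + 0|) + B * (|x - d| - |0 - d|) := by
  have h1 := abs_sub_abs_le_abs_sub d (d - x)
  rw [sub_sub_cancel, abs_sub_comm d x] at h1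
  simp only [sub_zero, zero_add, abs_zero, zero_sub, abs_neg]
  nlinarith [mul_le_mul_of_nonneg_left h1 hB, mul_le_mul_of_nonneg_right h (abs_nonneg x)]

/-- At an active coordinate both powers of the initial estimate have positive limits, so `λ / η → 0`
makes the adaptive weight negligible against the transfer weight. -/
theorem eventually_active_slope
    (H : IsEstimateSeq βs γ₁ γ₂ r₀ C z w N m X e lam eta βt βh) (heta : ∀ᶠ i in atTop, 0 < eta i)
    (h : Tendsto (fun i => lam i / eta i) atTop (𝓝 0)) {κ : ℝ} {j : Fin p} (hj : βs j ≠ 0)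
    (hκ : κ < |βs j| ^ γ₂) :
    ∀ᶠ i in atTop, κ * eta i ≤ eta i * |βt i j| ^ γ₂ - lam i / |βt i j| ^ γ₁ := by
  have h1 : Tendsto (fun i => |βt i j| ^ γ₂ - lam i / eta i / |βt i j| ^ γ₁) atTop
      (𝓝 (|βs j| ^ γ₂ - 0 / |βs j| ^ γ₁)) :=
    (H.tendsto_abs_initial_rpow H.gamma₂_nonneg j).sub
      (h.div (H.tendsto_abs_initial_rpow H.gamma₁_nonneg j)
        (Real.rpow_pos_of_pos (abs_pos.2 hj) _).ne')
  rw [zero_div, sub_zero] at h1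
  filter_upwards [h1.eventually_const_lt hκ, heta] with i h2 h3
  have h4 : eta i * |βt i j| ^ γ₂ - lam i / |βt i j| ^ γ₁ =
      (|βt i j| ^ γ₂ - lam i / eta i / |βt i j| ^ γ₁) * eta i := by
    field_simp
  rw [h4]
  gcongr

theorem sqrt_source_rpow_add
    (H : IsEstimateSeq βs γ₁ γ₂ r₀ C z w N m X e lam eta βt βh) : ∀ᶠ i in atTop,
    √((m i : ℝ) ^ (γ₁ + γ₂)) = √((m i : ℝ) ^ γ₁) * √((m i : ℝ) ^ γ₂) := by
  filter_upwards [H.source_pos] with i hi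
  have hm : (0 : ℝ) < m i := Nat.cast_pos.2 hi
  rw [Real.rpow_add hm, Real.sqrt_mul (Real.rpow_nonneg hm.le _)]

/-- The transfer penalty dominates at all coordinates. -/
theorem tendsto_of_eta_dominant
    (H : IsEstimateSeq βs γ₁ γ₂ r₀ C z w N m X e lam eta βt βh)
    (hz : 0 < γ₂ → ∀ j, βs j = 0 → z j ≠ 0)
    (heta : Tendsto (fun i => eta i / √(N i * (m i : ℝ) ^ γ₂)) atTop atTop)
    (hlam : Tendsto (fun i => √((m i : ℝ) ^ (γ₁ + γ₂)) * lam i / eta i) atTop (𝓝 0)) :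
    Tendsto (fun i => √(m i : ℝ) • (βh i - βs)) atTop (𝓝 z) := by
  have hetapos : ∀ᶠ i in atTop, 0 < eta i := by
    filter_upwards [heta.eventually_gt_atTop 0] with i hi
    rcases (H.eta_nonneg i).eq_or_lt with h | h
    · simp [← h] at hi
    · exact h
  have hratio : Tendsto (fun i => lam i / eta i) atTop (𝓝 0) := by
    refine squeeze_zero' (Eventually.of_forall fun i =>
      div_nonneg (H.lam_nonneg i) (H.eta_nonneg i)) ?_ hlam
    filter_upwards [H.eventually_one_le_sqrt_source_rpow
      (add_nonneg H.gamma₁_nonneg H.gamma₂_nonneg)] with i hi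
    rw [mul_div_assoc]
    exact le_mul_of_one_le_left (div_nonneg (H.lam_nonneg i) (H.eta_nonneg i)) hi
  obtain ⟨κ, hκ, hκ0⟩ : ∃ κ : ℝ, (κ < 1 ∧ (∀ j, βs j ≠ 0 → κ < |βs j| ^ γ₂) ∧
      ∀ j, z j ≠ 0 → κ < |z j| ^ γ₂) ∧ 0 < κ := by
    have hsmall : ∀ x : ℝ, 0 < x → ∀ᶠ κ in 𝓝[>] (0 : ℝ), κ < x := fun x hx =>
      (eventually_lt_nhds hx).filter_mono nhdsWithin_le_nhds
    refine (Eventually.and (Eventually.and (hsmall 1 one_pos) (Eventually.and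
      (eventually_all.2 fun j => ?_) (eventually_all.2 fun j => ?_)))
      self_mem_nhdsWithin).exists
    · by_cases hj : βs j = 0
      · exact Eventually.of_forall fun _ h => absurd hj h
      · filter_upwards [hsmall _ (Real.rpow_pos_of_pos (abs_pos.2 hj) γ₂)] with κ h _ using h
    · by_cases hj : z j = 0
      · exact Eventually.of_forall fun _ h => absurd hj h
      · filter_upwards [hsmall _ (Real.rpow_pos_of_pos (abs_pos.2 hj) γ₂)] with κ h _ using h
  have hslope : ∀ᶠ i in atTop, ∀ j, βs j ≠ 0 ∨ z j ≠ 0 →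
      κ * eta i / √((m i : ℝ) ^ γ₂) ≤ eta i * |βt i j| ^ γ₂ - lam i / |βt i j| ^ γ₁ := by
    refine eventually_all.2 fun j => ?_
    by_cases hj : βs j = 0
    · by_cases hzj : z j = 0
      · exact Eventually.of_forall fun _ h => absurd h (by simp [hj, hzj])
      have h1 := (H.tendsto_abs_scaled_rpow (γ := γ₂) (Or.inl hzj)).sub
        (hlam.div (H.tendsto_abs_scaled_rpow (γ := γ₁) (Or.inl hzj))
          (Real.rpow_pos_of_pos (abs_pos.2 hzj) _).ne')
      rw [zero_div, sub_zero] at h1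
      filter_upwards [h1.eventually_const_lt (hκ.2.2 j hzj), hetapos, H.abs_initial_rpow_eq γ₁ hj,
        H.abs_initial_rpow_eq γ₂ hj, H.sqrt_source_rpow_add, H.source_pos] with i h2 h3 h4 h5 h6 h7 _
      have hm : (0 : ℝ) < m i := Nat.cast_pos.2 h7
      have h8 : 0 < √((m i : ℝ) ^ γ₂) := Real.sqrt_pos.2 (Real.rpow_pos_of_pos hm _)
      simp only [Pi.div_apply] at h2
      rw [h6] at h2
      rw [h4, h5]
      set a := |√(m i : ℝ) * (βt i j - βs j)| ^ γ₂
      set b := |√(m i : ℝ) * (βt i j - βs j)| ^ γ₁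
      have h9 : eta i * (a / √((m i : ℝ) ^ γ₂)) - lam i / (b / √((m i : ℝ) ^ γ₁)) =
          (a - √((m i : ℝ) ^ γ₁) * √((m i : ℝ) ^ γ₂) * lam i / eta i / b) * eta i
            / √((m i : ℝ) ^ γ₂) := by
        rw [div_div_eq_mul_div]
        field_simp
      rw [h9]
      gcongr
    · filter_upwards [H.eventually_active_slope hetapos hratio hj (hκ.2.1 j hj),
        H.eventually_one_le_sqrt_source_rpow H.gamma₂_nonneg, hetapos] with i h1 h2 h3 _
      exact (div_le_self (by positivity) h2).trans h1
  have hbad : ∀ j, ¬(βs j ≠ 0 ∨ z j ≠ 0) → βs j = 0 ∧ z j = 0 ∧ γ₂ = 0 := by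
    intro j hj
    push Not at hj
    refine ⟨hj.1, hj.2, ?_⟩
    by_contra h
    exact hz (lt_of_le_of_ne H.gamma₂_nonneg (Ne.symm h)) j hj.1 hj.2
  have hpos : ∀ᶠ i in atTop, ∀ j, βs j ≠ 0 ∨ z j ≠ 0 → 0 < |βt i j| ^ γ₁ := by
    refine eventually_all.2 fun j => ?_
    by_cases hj : βs j ≠ 0 ∨ z j ≠ 0
    · filter_upwards [H.eventually_initial_rpow_pos (hj.imp id Or.inl)] with i hi _ using hi
    · exact Eventually.of_forall fun _ h => absurd h hj
  -- Where `β*_j = z_j = 0`, which leaves only `γ₂ = 0`, the adaptive weight has no upper bound and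
  -- may be infinite. The competitor is set to `0` there instead of the scaled initial error, the
  -- adaptive penalty is dropped, and the cost of moving the pin, twice that error, goes into `δ`.
  have hδ : Tendsto (fun i => 2 / κ * ∑ j, if βs j ≠ 0 ∨ z j ≠ 0 then 0
      else |√(m i : ℝ) * (βt i j - βs j)|) atTop (𝓝 0) := by
    have h1 : Tendsto (fun i => ∑ j, if βs j ≠ 0 ∨ z j ≠ 0 then 0
        else |√(m i : ℝ) * (βt i j - βs j)|) atTop (𝓝 (∑ _j : Fin p, 0)) := by
      refine tendsto_finsetSum _ fun j _ => ?_
      by_cases hj : βs j ≠ 0 ∨ z j ≠ 0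
      · simp only [if_pos hj]
        exact tendsto_const_nhds
      · simp only [if_neg hj]
        have := (H.tendsto_initial_apply j).abs
        rwa [(hbad j hj).2.1, abs_zero] at this
    simpa using h1.const_mul (2 / κ)
  refine H.tendsto_sqrt_source_smul_sub
    (A := fun i j => if βs j ≠ 0 ∨ z j ≠ 0 then lam i / |βt i j| ^ γ₁ else 0)
    (cs := fun i j => if βs j ≠ 0 ∨ z j ≠ 0 then √(m i : ℝ) * (βt i j - βs j) else 0)
    (α := fun i => κ * eta i / √((m i : ℝ) ^ γ₂)) (Eventually.of_forall fun i j => ?_) ?_ ?_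
    (fun j => ?_) ?_ hδ ?_
  · have := H.lam_nonneg i
    split_ifs <;> positivity
  · filter_upwards [hpos] with i hi j
    split_ifs with hj
    · exact (ofReal_div_eq_weight (hi j hj)).le
    · simp
  · filter_upwards [hpos] with i hi j
    split_ifs with hj
    · exact Or.inr (ofReal_div_eq_weight (hi j hj))
    · left
      simp [(hbad j hj).1]
  · by_cases hj : βs j ≠ 0 ∨ z j ≠ 0
    · simp only [if_pos hj]
      exact H.tendsto_initial_apply j
    · simp only [if_neg hj]
      rw [(hbad j hj).2.1]
      exact tendsto_const_nhds
  · refine (heta.const_mul_atTop hκ0).congr fun i => ?_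
    rw [Real.sqrt_mul (Nat.cast_nonneg _)]
    simp only [div_eq_mul_inv, mul_inv]
    ring
  · filter_upwards [hslope, hetapos] with i h1 h2 j x
    have hα0 : 0 ≤ κ * eta i / √((m i : ℝ) ^ γ₂) := by positivity
    have hsum0 : ∀ k ∈ Finset.univ, 0 ≤ if βs k ≠ 0 ∨ z k ≠ 0 then 0
        else |√(m i : ℝ) * (βt i k - βs k)| := fun k _ => by split_ifs <;> positivity
    by_cases hj : βs j ≠ 0 ∨ z j ≠ 0
    · simp only [if_pos hj]
      refine le_trans ?_ (mul_abs_sub_le_of_initial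
        (div_nonneg (H.lam_nonneg i) (Real.rpow_nonneg (abs_nonneg _) _)) (h1 j hj))
      refine mul_le_mul_of_nonneg_left ?_ hα0
      have := mul_nonneg (by positivity : 0 ≤ 2 / κ) (Finset.sum_nonneg hsum0)
      linarith
    · simp only [if_neg hj]
      obtain ⟨hj1, -, hj3⟩ := hbad j hj
      have h3 := Finset.single_le_sum hsum0 (Finset.mem_univ j)
      rw [if_neg hj] at h3
      rw [hj3]
      simp only [Real.rpow_zero, Real.sqrt_one, div_one, mul_one, zero_mul, zero_add, sub_zero,
        zero_sub, abs_neg]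
      set d := √(m i : ℝ) * (βt i j - βs j)
      set S := ∑ k, if βs k ≠ 0 ∨ z k ≠ 0 then 0 else |√(m i : ℝ) * (βt i k - βs k)|
      have h4 : |x| - |d| ≤ |x - d| := abs_sub_abs_le_abs_sub x d
      have h5 : κ * eta i * (|x| - 2 / κ * S) = eta i * (κ * |x| - 2 * S) := by
        field_simp
      rw [h5]
      refine mul_le_mul_of_nonneg_left ?_ h2.le
      -- Here `γ₂ = 0` makes the transfer weight equal to `η`, so the slope `κ η` is admissible
      -- because `κ < 1`.
      have h6 : κ * |x| ≤ 1 * |x| := by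
        gcongr
        exact hκ.1.le
      linarith

/-- The transfer penalty dominates at the active coordinates, the adaptive penalty dominates at the
inactive ones. -/
theorem tendsto_of_both_dominant
    (H : IsEstimateSeq βs γ₁ γ₂ r₀ C z w N m X e lam eta βt βh)
    (hlam : Tendsto (fun i => √((m i : ℝ) ^ γ₁ / N i) * lam i) atTop atTop)
    (heta : Tendsto (fun i => eta i / √(N i : ℝ)) atTop atTop)
    (hratio : Tendsto (fun i => eta i / lam i) atTop atTop)
    (hratio' : Tendsto (fun i => eta i / (√((m i : ℝ) ^ (γ₁ + γ₂)) * lam i)) atTop (𝓝 0)) :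
    Tendsto (fun i => √(m i : ℝ) • (βh i - βs)) atTop
      (𝓝 (WithLp.toLp 2 fun j => if j ∈ active βs then z j else 0)) := by
  have hmem : ∀ j, j ∈ active βs ↔ βs j ≠ 0 := by simp [active]
  have hetapos : ∀ᶠ i in atTop, 0 < eta i := by
    filter_upwards [heta.eventually_gt_atTop 0] with i hi
    rcases (H.eta_nonneg i).eq_or_lt with h | h
    · simp [← h] at hi
    · exact h
  have hlampos : ∀ᶠ i in atTop, 0 < lam i := by
    filter_upwards [hlam.eventually_gt_atTop 0] with i hi
    exact pos_of_mul_pos_right hi (Real.sqrt_nonneg _)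
  have hratio₀ : Tendsto (fun i => lam i / eta i) atTop (𝓝 0) := by
    refine hratio.inv_tendsto_atTop.congr fun i => ?_
    rw [Pi.inv_apply, inv_div]
  have hM : 0 < (‖z‖ + 1) ^ γ₁ := by positivity
  obtain ⟨κ, hκ, hκ0⟩ : ∃ κ : ℝ, (κ < 1 / (‖z‖ + 1) ^ γ₁ ∧
      ∀ j, βs j ≠ 0 → κ < |βs j| ^ γ₂) ∧ 0 < κ := by
    have hsmall : ∀ x : ℝ, 0 < x → ∀ᶠ κ in 𝓝[>] (0 : ℝ), κ < x := fun x hx =>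
      (eventually_lt_nhds hx).filter_mono nhdsWithin_le_nhds
    refine (Eventually.and (Eventually.and (hsmall _ (by positivity))
      (eventually_all.2 fun j => ?_)) self_mem_nhdsWithin).exists
    by_cases hj : βs j = 0
    · exact Eventually.of_forall fun _ h => absurd hj h
    · filter_upwards [hsmall _ (Real.rpow_pos_of_pos (abs_pos.2 hj) γ₂)] with κ h _ using h
  have hactive : ∀ᶠ i in atTop, ∀ j, βs j ≠ 0 →
      κ * eta i ≤ eta i * |βt i j| ^ γ₂ - lam i / |βt i j| ^ γ₁ := by
    refine eventually_all.2 fun j => ?_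
    by_cases hj : βs j = 0
    · exact Eventually.of_forall fun _ h => absurd hj h
    · filter_upwards [H.eventually_active_slope hetapos hratio₀ hj (hκ.2 j hj)] with i h _ using h
  have hinactive : ∀ᶠ i in atTop, ∀ j, βs j = 0 → κ * (lam i * √((m i : ℝ) ^ γ₁)) ≤
      lam i * √((m i : ℝ) ^ γ₁) / (‖z‖ + 1) ^ γ₁ - eta i * |βt i j| ^ γ₂ := by
    refine eventually_all.2 fun j => ?_
    by_cases hj : βs j = 0
    · have h1 := (hratio'.mul (H.tendsto_abs_scaled_rpow (j := j)
        (Or.inr H.gamma₂_nonneg))).const_sub (1 / (‖z‖ + 1) ^ γ₁)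
      rw [zero_mul, sub_zero] at h1
      filter_upwards [h1.eventually_const_lt hκ.1, hlampos, H.abs_initial_rpow_eq γ₂ hj,
        H.sqrt_source_rpow_add, H.source_pos] with i h2 h3 h4 h5 h6 _
      have hm : (0 : ℝ) < m i := Nat.cast_pos.2 h6
      have h7 : 0 < √((m i : ℝ) ^ γ₁) := Real.sqrt_pos.2 (Real.rpow_pos_of_pos hm _)
      have h8 : 0 < √((m i : ℝ) ^ γ₂) := Real.sqrt_pos.2 (Real.rpow_pos_of_pos hm _)
      rw [h5] at h2
      rw [h4]
      set a := |√(m i : ℝ) * (βt i j - βs j)| ^ γ₂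
      have h9 : lam i * √((m i : ℝ) ^ γ₁) / (‖z‖ + 1) ^ γ₁ - eta i * (a / √((m i : ℝ) ^ γ₂)) =
          (1 / (‖z‖ + 1) ^ γ₁ - eta i / (√((m i : ℝ) ^ γ₁) * √((m i : ℝ) ^ γ₂) * lam i) * a)
            * (lam i * √((m i : ℝ) ^ γ₁)) := by
        field_simp
      rw [h9]
      gcongr
    · exact Eventually.of_forall fun _ h => absurd h hj
  have heq : ∀ᶠ i in atTop, ∀ j, βs j ≠ 0 → ENNReal.ofReal (lam i / |βt i j| ^ γ₁) =
      ENNReal.ofReal (lam i) * (ENNReal.ofReal (|βt i j| ^ γ₁))⁻¹ := by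
    refine eventually_all.2 fun j => ?_
    by_cases hj : βs j = 0
    · exact Eventually.of_forall fun _ h => absurd hj h
    · filter_upwards [H.eventually_initial_rpow_pos (Or.inl hj)] with i hi _
      exact ofReal_div_eq_weight hi
  have hle : ∀ᶠ i in atTop, ∀ j, βs j = 0 →
      ENNReal.ofReal (lam i * √((m i : ℝ) ^ γ₁) / (‖z‖ + 1) ^ γ₁) ≤
      ENNReal.ofReal (lam i) * (ENNReal.ofReal (|βt i j| ^ γ₁))⁻¹ := by
    refine eventually_all.2 fun j => ?_
    by_cases hj : βs j = 0
    · filter_upwards [H.eventually_weight_le hlampos hj] with i hi _ using hi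
    · exact Eventually.of_forall fun _ h => absurd h hj
  refine H.tendsto_sqrt_source_smul_sub
    (A := fun i j => if βs j = 0 then lam i * √((m i : ℝ) ^ γ₁) / (‖z‖ + 1) ^ γ₁
      else lam i / |βt i j| ^ γ₁)
    (cs := fun i j => if βs j = 0 then 0 else √(m i : ℝ) * (βt i j - βs j))
    -- The common slope is the smaller of the two dominating weights: the transfer weight at active
    -- coordinates, the bound for the adaptive weight at inactive ones. Both diverge faster than
    -- `√N`.
    (α := fun i => κ * min (eta i) (lam i * √((m i : ℝ) ^ γ₁)))
    (δ := fun _ => 0) (Eventually.of_forall fun i j => ?_) ?_ ?_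
    (fun j => ?_) ?_ tendsto_const_nhds ?_
  · have := H.lam_nonneg i
    split_ifs <;> positivity
  · filter_upwards [heq, hle] with i h1 h2 j
    split_ifs with hj
    · exact h2 j hj
    · exact (h1 j hj).le
  · filter_upwards [heq] with i h1 j
    by_cases hj : βs j = 0
    · left
      simp [hj]
    · right
      simp only [hj, if_false]
      exact h1 j hj
  · by_cases hj : βs j = 0
    · simp only [hj, if_true, hmem, ne_eq, not_true, if_false]
      exact tendsto_const_nhds
    · simp only [hj, if_false, hmem, ne_eq, not_false_iff, if_true]
      exact H.tendsto_initial_apply j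
  · have hlam' : Tendsto (fun i => lam i * √((m i : ℝ) ^ γ₁) / √(N i : ℝ)) atTop atTop := by
      refine hlam.congr fun i => ?_
      rw [Real.sqrt_div (Real.rpow_nonneg (Nat.cast_nonneg _) _)]
      ring
    refine tendsto_atTop.2 fun b => ?_
    filter_upwards [(heta.const_mul_atTop hκ0).eventually_ge_atTop b,
      (hlam'.const_mul_atTop hκ0).eventually_ge_atTop b] with i h1 h2
    rw [mul_div_assoc]
    rcases min_choice (eta i) (lam i * √((m i : ℝ) ^ γ₁)) with h | h <;> rw [h]
    · exact h1
    · exact h2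
  · filter_upwards [hactive, hinactive] with i h1 h2 j x
    rw [sub_zero]
    by_cases hj : βs j = 0
    · simp only [hj, if_true, mul_zero]
      refine mul_abs_le_of_zero (mul_nonneg (H.eta_nonneg i) (by positivity)) ?_
      refine le_trans ?_ (h2 j hj)
      gcongr
      exact min_le_right _ _
    · simp only [hj, if_false]
      refine mul_abs_sub_le_of_initial (div_nonneg (H.lam_nonneg i) (by positivity)) ?_
      refine le_trans ?_ (h1 j hj)
      gcongr
      exact min_le_left _ _

end SqrtSource

end IsEstimateSeq

/-! ### From realizations to distributions -/

/-- Reduction of the asymptotic distribution of the estimators to the convergence of realizations. -/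
theorem tendstoInDistribution_of_isEstimateSeq
    {Ω Ω' : Type*} [MeasurableSpace Ω] [MeasurableSpace Ω']
    {P : Measure Ω} [IsProbabilityMeasure P] {P' : Measure Ω'} [IsProbabilityMeasure P']
    {p : ℕ} {βs : Coef p} {σ : ℝ≥0} {γ₁ γ₂ : ℝ} (hγ₁ : 0 ≤ γ₁) (hγ₂ : 0 ≤ γ₂)
    {X : (n : ℕ) → Matrix (Fin n) (Fin p) ℝ} {C : Matrix (Fin p) (Fin p) ℝ} (hC : C.PosDef)
    (hXC : Tendsto (fun n : ℕ => (1 / n : ℝ) • ((X n)ᵀ * X n)) atTop (𝓝 C))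
    {ε : (n : ℕ) → Fin n → Ω → ℝ}
    (hε : ∀ n i, HasLaw (ε n i) (gaussianReal 0 (σ ^ 2)) P)
    (hεindep : ∀ n, iIndepFun (ε n) P)
    {m : ℕ → ℕ} (hm : ∀ᶠ n in atTop, 0 < m n)
    {r₀ : ℝ} (hr₀ : Tendsto (fun n : ℕ => (n : ℝ) / m n) atTop (𝓝 r₀))
    {βt : ℕ → Ω → Coef p}
    (hβtε : ∀ n, IndepFun (βt n) (fun ω i => ε n i ω) P)
    {z W : Ω' → Coef p}
    (hz : TendstoInDistribution (fun n ω => √(m n : ℝ) • (βt n ω - βs)) atTop z (fun _ => P) P')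
    (hW : HasLaw W (multivariateGaussian 0 ((σ : ℝ) ^ 2 • C)) P')
    (hzW : IndepFun z W P')
    {lam eta : ℕ → ℝ} (hlam : ∀ n, 0 ≤ lam n) (heta : ∀ n, 0 ≤ eta n)
    {βh : ℕ → Ω → Coef p} (hβh : ∀ n, AEMeasurable (βh n) P)
    (hmin : ∀ n, ∀ᵐ ω ∂P, IsEstimate (X n) (response (X n) βs (fun i => ε n i ω)) (βt n ω)
      (lam n) (eta n) γ₁ γ₂ (βh n ω))
    (s : ℕ → ℝ) {G : Ω' → Coef p} (hG : AEMeasurable G P')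
    (h : ∀ᵐ ω ∂P', ∀ (k : ℕ → ℕ) (e : (i : ℕ) → Fin (k i) → ℝ) (bt bh : ℕ → Coef p),
      Tendsto k atTop atTop →
      IsEstimateSeq βs γ₁ γ₂ r₀ C (z ω) (W ω) k (m ∘ k) (fun i => X (k i)) e (lam ∘ k) (eta ∘ k)
        bt bh → Tendsto (fun i => s (k i) • (bh i - βs)) atTop (𝓝 (G ω))) :
    TendstoInDistribution (fun n ω => s n • (βh n ω - βs)) atTop G (fun _ => P) P' := by
  have hjoint := tendstoInDistribution_prodMk_of_indepFun hz
    (tendstoInDistribution_score hC hXC hε hεindep hW)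
    (fun n => (hβtε n).comp (φ := fun b => √(m n : ℝ) • (b - βs)) (ψ := score (X n))
      (by fun_prop) (measurable_score _)) hzW
  refine tendstoInDistribution_of_forall_seq
    -- The noise cannot be recovered from the score, so the relation only asks that some noise,
    -- initial estimate and minimizer realize the given values. The deterministic limits depend on
    -- the noise through the score alone.
    (fun n x y => ∃ (e : Fin n → ℝ) (bt bh : Coef p),
      IsEstimate (X n) (response (X n) βs e) bt (lam n) (eta n) γ₁ γ₂ bh ∧
      x = (√(m n : ℝ) • (bt - βs), score (X n) e) ∧ y = s n • (bh - βs)) hjoint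
    (fun n => ((hβh n).sub_const βs).const_smul (s n)) hG (fun n => ?_) ?_
  · filter_upwards [hmin n] with ω hω
    exact ⟨fun i => ε n i ω, βt n ω, βh n ω, hω, rfl, rfl⟩
  · filter_upwards [h] with ω hω k x y hk hx hR
    choose e bt bh hest hxe hy using hR
    have hx1 : Tendsto (fun i => (x i).1) atTop (𝓝 (z ω)) := (continuous_fst.tendsto _).comp hx
    have hx2 : Tendsto (fun i => (x i).2) atTop (𝓝 (W ω)) := (continuous_snd.tendsto _).comp hx
    simp only [hxe] at hx1 hx2
    have hlim := hω k e bt bh hk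
      { posDef := hC
        gamma₁_nonneg := hγ₁
        gamma₂_nonneg := hγ₂
        tendsto_size := hk
        source_pos := hk.eventually hm
        tendsto_ratio := hr₀.comp hk
        tendsto_gram := hXC.comp hk
        tendsto_score := hx2
        tendsto_initial := hx1
        lam_nonneg := fun i => hlam _
        eta_nonneg := fun i => heta _
        isEstimate := hest }
    exact hlim.congr fun i => (hy i).symm

theorem IsArgmin.congr {p : ℕ} {U V : Set (Coef p)} {f g : Coef p → ℝ} {u : Coef p}
    (h : IsArgmin U f u) (hUV : ∀ v, v ∈ U ↔ v ∈ V) (hfg : ∀ v, f v = g v) : IsArgmin V g u := by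
  obtain rfl : U = V := Set.ext hUV
  obtain rfl : f = g := funext hfg
  exact h

theorem mem_active {p : ℕ} {β : Coef p} {j : Fin p} : j ∈ active β ↔ β j ≠ 0 := by
  simp [active]

end AdaptiveTransferLasso

/-! ### The six regimes -/

theorem mainTheorem1
    {Ω Ω' : Type*} [MeasurableSpace Ω] [MeasurableSpace Ω']
    (P : Measure Ω) [IsProbabilityMeasure P] (P' : Measure Ω') [IsProbabilityMeasure P']
    {p : ℕ} (βs : Coef p) (σ : ℝ≥0) (γ₁ γ₂ : ℝ) (hγ₁ : 0 ≤ γ₁) (hγ₂ : 0 ≤ γ₂)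
    -- the designs and their limit
    (X : (n : ℕ) → Matrix (Fin n) (Fin p) ℝ) (C : Matrix (Fin p) (Fin p) ℝ) (hC : C.PosDef)
    (hXC : Tendsto (fun n : ℕ => (1 / n : ℝ) • ((X n)ᵀ * X n)) atTop (𝓝 C))
    (hXmax : Tendsto (fun n : ℕ => (1 / n : ℝ) * ⨆ i : Fin n, ‖WithLp.toLp 2 (X n i)‖ ^ 2)
      atTop (𝓝 0))
    -- i.i.d. Gaussian noise
    (ε : (n : ℕ) → Fin n → Ω → ℝ)
    (hε : ∀ n i, HasLaw (ε n i) (gaussianReal 0 (σ ^ 2)) P)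
    (hεindep : ∀ n, iIndepFun (ε n) P)
    -- source sample sizes and the initial estimator
    (m : ℕ → ℕ) (hm : ∀ᶠ n in atTop, 0 < m n)
    (r₀ : ℝ) (hr₀ : Tendsto (fun n : ℕ => (n : ℝ) / m n) atTop (𝓝 r₀))
    (βt : ℕ → Ω → Coef p) (hβt : ∀ n, AEMeasurable (βt n) P)
    (hβtε : ∀ n, IndepFun (βt n) (fun ω i => ε n i ω) P)
    -- the limit `z` of the initial estimator and the Gaussian vector `W`
    (z W : Ω' → Coef p)
    (hz : TendstoInDistribution (fun n ω => √(m n : ℝ) • (βt n ω - βs)) atTop z (fun _ => P) P')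
    (hW : HasLaw W (multivariateGaussian 0 ((σ : ℝ) ^ 2 • C)) P')
    (hzW : IndepFun z W P')
    -- the tuning parameters and the estimator
    (lam eta : ℕ → ℝ) (hlam : ∀ n, 0 ≤ lam n) (heta : ∀ n, 0 ≤ eta n)
    (βh : ℕ → Ω → Coef p) (hβh : ∀ n, AEMeasurable (βh n) P)
    (hmin : ∀ n, ∀ᵐ ω ∂P, IsEstimate (X n) (response (X n) βs (fun i => ε n i ω)) (βt n ω)
      (lam n) (eta n) γ₁ γ₂ (βh n ω)) :
    -- (i)
    ((0 < γ₂ → ∀ j ∉ active βs, ∀ᵐ ω ∂P', z ω j ≠ 0) →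
      Tendsto (fun n : ℕ => eta n / √(n * (m n : ℝ) ^ γ₂)) atTop atTop →
      Tendsto (fun n : ℕ => √((m n : ℝ) ^ (γ₁ + γ₂)) * lam n / eta n) atTop (𝓝 0) →
      TendstoInDistribution (fun n ω => √(m n : ℝ) • (βh n ω - βs)) atTop z (fun _ => P) P')
    ∧
    -- (ii)
    (∀ ρ₀ : ℝ≥0∞,
      Tendsto (fun n : ℕ => √((m n : ℝ) ^ γ₁ / n) * lam n) atTop atTop →
      Tendsto (fun n : ℕ => eta n / √(n : ℝ)) atTop atTop →
      Tendsto (fun n : ℕ => eta n / lam n) atTop atTop →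
      Tendsto (fun n : ℕ => eta n / (√((m n : ℝ) ^ (γ₁ + γ₂)) * lam n)) atTop (𝓝 0) →
      Tendsto (fun n : ℕ => ENNReal.ofReal (√((m n : ℝ) ^ γ₁) * lam n / eta n)) atTop (𝓝 ρ₀) →
      TendstoInDistribution (fun n ω => √(m n : ℝ) • (βh n ω - βs)) atTop
        (fun ω => WithLp.toLp 2 (fun j => if j ∈ active βs then z ω j else 0))
        (fun _ => P) P')
    ∧
    -- (iii)
    (∀ lam₁ eta₀ : ℝ,
      (γ₁ = 0 → lam₁ = 0) → (γ₂ = 0 → eta₀ = 0) →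
      (0 < γ₁ → ∀ j ∉ active βs, ∀ᵐ ω ∂P', z ω j ≠ 0) →
      Tendsto (fun n : ℕ => √((m n : ℝ) ^ γ₁ / n) * lam n) atTop (𝓝 lam₁) →
      Tendsto (fun n : ℕ => eta n / √(n : ℝ)) atTop (𝓝 eta₀) →
      ∃ uh : Ω' → Coef p,
        (∀ᵐ ω ∂P', IsArgmin Set.univ
          (fun u => quad C u - 2 * (u.ofLp ⬝ᵥ (W ω).ofLp)
            + ∑ j ∈ (active βs)ᶜ, lam₁ / |z ω j| ^ γ₁ * |u j|
            + ∑ j ∈ active βs, eta₀ * |βs j| ^ γ₂ * |u j - √r₀ * z ω j|) (uh ω)) ∧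
        TendstoInDistribution (fun (n : ℕ) ω => √(n : ℝ) • (βh n ω - βs)) atTop uh (fun _ => P) P')
    ∧
    -- (iv)
    (∀ lam₁ eta₁ : ℝ,
      (0 < γ₁ → ∀ j ∉ active βs, ∀ᵐ ω ∂P', z ω j ≠ 0) →
      Tendsto (fun n : ℕ => √((m n : ℝ) ^ γ₁ / n) * lam n) atTop (𝓝 lam₁) →
      Tendsto (fun n : ℕ => eta n / √(n : ℝ)) atTop atTop →
      Tendsto (fun n : ℕ => eta n / √(n * (m n : ℝ) ^ γ₂)) atTop (𝓝 eta₁) →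
      ∃ uh : Ω' → Coef p,
        (∀ᵐ ω ∂P', IsArgmin {u | ∀ j ∈ active βs, u j = √r₀ * z ω j}
          (fun u => quad C u - 2 * (u.ofLp ⬝ᵥ (W ω).ofLp)
            + ∑ j ∈ (active βs)ᶜ, (lam₁ / |z ω j| ^ γ₁ * |u j|
              + eta₁ * |z ω j| ^ γ₂ * |u j - √r₀ * z ω j|)) (uh ω)) ∧
        TendstoInDistribution (fun (n : ℕ) ω => √(n : ℝ) • (βh n ω - βs)) atTop uh (fun _ => P) P')
    ∧
    -- (v)
    (∀ lam₀ eta₀ : ℝ,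
      Tendsto (fun n : ℕ => √((m n : ℝ) ^ γ₁ / n) * lam n) atTop atTop →
      Tendsto (fun n : ℕ => lam n / √(n : ℝ)) atTop (𝓝 lam₀) →
      Tendsto (fun n : ℕ => eta n / √(n : ℝ)) atTop (𝓝 eta₀) →
      ∃ uh : Ω' → Coef p,
        (∀ᵐ ω ∂P', IsArgmin {u | ∀ j ∉ active βs, u j = 0}
          (fun u => quad C u - 2 * (u.ofLp ⬝ᵥ (W ω).ofLp)
            + ∑ j ∈ active βs, (lam₀ * (SignType.sign (βs j) / |βs j| ^ γ₁) * u j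
              + eta₀ * |βs j| ^ γ₂ * |u j - √r₀ * z ω j|)) (uh ω)) ∧
        TendstoInDistribution (fun (n : ℕ) ω => √(n : ℝ) • (βh n ω - βs)) atTop uh (fun _ => P) P')
    ∧
    -- (vi)
    (0 < γ₁ →
      Tendsto (fun n : ℕ => lam n / √(n : ℝ)) atTop atTop →
      Tendsto (fun n : ℕ => lam n / n) atTop (𝓝 0) →
      Tendsto (fun n : ℕ => eta n / lam n) atTop (𝓝 0) →
      ∃ u₀ : Coef p,
        IsArgmin {u | ∀ j ∉ active βs, u j = 0}
          (fun u => quad C u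
            + ∑ j ∈ active βs, SignType.sign (βs j) / |βs j| ^ γ₁ * u j) u₀ ∧
        TendstoInDistribution (fun (n : ℕ) ω => ((n : ℝ) / lam n) • (βh n ω - βs)) atTop
          (fun _ : Ω' => u₀) (fun _ => P) P') := by
  have hzm : AEMeasurable z P' := hz.aemeasurable_limit
  have hWm : AEMeasurable W P' := hW.aemeasurable
  have hreduce := fun (s : ℕ → ℝ) (G : Ω' → Coef p) (hG : AEMeasurable G P') =>
    tendstoInDistribution_of_isEstimateSeq hγ₁ hγ₂ hC hXC hε hεindep hm hr₀ hβtε hz hW hzW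
      hlam heta hβh hmin s hG
  have hae : ∀ γ : ℝ, (0 < γ → ∀ j ∉ active βs, ∀ᵐ ω ∂P', z ω j ≠ 0) →
      ∀ᵐ ω ∂P', 0 < γ → ∀ j, βs j = 0 → z ω j ≠ 0 := by
    intro γ h
    by_cases hγ : 0 < γ
    · have h1 : ∀ j, ∀ᵐ ω ∂P', βs j = 0 → z ω j ≠ 0 := by
        intro j
        by_cases hj : βs j = 0
        · filter_upwards [h hγ j (by simp [mem_active, hj])] with ω hω _ using hω
        · exact Eventually.of_forall fun _ h0 => absurd h0 hj
      filter_upwards [ae_all_iff.2 h1] with ω hω _ using hω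
    · exact Eventually.of_forall fun _ h0 => absurd h0 hγ
  refine ⟨?_, ?_, ?_, ?_, ?_, ?_⟩
  · intro hN h1 h2
    refine hreduce (fun n => √(m n : ℝ)) z hzm ?_
    filter_upwards [hae γ₂ hN] with ω hω k e bt bh hk H
    exact H.tendsto_of_eta_dominant hω (h1.comp hk) (h2.comp hk)
  · intro ρ₀ h1 h2 h3 h4 _
    refine hreduce (fun n => √(m n : ℝ)) _ ?_ ?_
    · have : Measurable fun x : Coef p =>
          (WithLp.toLp 2 fun j => if j ∈ active βs then x j else 0 : Coef p) := by
        refine (WithLp.measurable_toLp 2 _).comp (measurable_pi_lambda _ fun j => ?_)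
        split_ifs <;> fun_prop
      exact this.comp_aemeasurable hzm
    · refine Eventually.of_forall fun ω k e bt bh hk H => ?_
      exact H.tendsto_of_both_dominant (h1.comp hk) (h2.comp hk) (h3.comp hk) (h4.comp hk)
  · intro lam₁ eta₀ hlam₁ heta₀ hN h1 h2
    have hl : 0 ≤ lam₁ := ge_of_tendsto' h1 fun n => mul_nonneg (Real.sqrt_nonneg _) (hlam n)
    have he : 0 ≤ eta₀ := ge_of_tendsto' h2 fun n => div_nonneg (heta n) (Real.sqrt_nonneg _)
    obtain ⟨g, hg, hgmin⟩ := exists_continuous_isArgmin hC βs Finset.univ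
    -- The parameters of the limit objective are measurable in `(z, W)`. Composed with the
    -- continuous argmin map `g` they give a measurable limit.
    let θ : Coef p × Coef p →
        Coef p × (Fin p → ℝ) × (Fin p → ℝ) × (Fin p → ℝ) × (Fin p → ℝ) := fun q =>
      (q.2, fun j => if βs j = 0 then lam₁ / |q.1 j| ^ γ₁ else 0, fun j => eta₀ * |βs j| ^ γ₂,
        fun j => √r₀ * q.1 j, fun _ => 0)
    have hθ : Measurable θ := by
      refine measurable_snd.prodMk ((measurable_pi_lambda _ fun j => ?_).prodMk
        (measurable_const.prodMk ((by fun_prop : Measurable _).prodMk measurable_const)))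
      split_ifs <;> fun_prop
    have hmn := fun ω => hgmin (W ω) (fun j => if βs j = 0 then lam₁ / |z ω j| ^ γ₁ else 0)
      (fun j => eta₀ * |βs j| ^ γ₂) (fun j => √r₀ * z ω j) (fun _ => 0)
      (fun j => by split_ifs <;> positivity) (fun j => by positivity)
    refine ⟨fun ω => g (θ (z ω, W ω)), Eventually.of_forall fun ω => ?_, ?_⟩
    · refine (hmn ω).congr (fun v => by simp) fun v => ?_
      rw [add_assoc, ← Finset.sum_compl_add_sum (active βs)]
      congr 2
      · refine Finset.sum_congr rfl fun j hj => ?_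
        have hj : βs j = 0 := by simpa [active] using hj
        -- The transfer term disappears at inactive coordinates: `0 ^ γ₂ = 0` if `γ₂ > 0`, while `η₀
        -- = 0` is assumed when `γ₂ = 0`, where `0 ^ 0 = 1`.
        have h0 : eta₀ * |βs j| ^ γ₂ = 0 := by
          rcases hγ₂.eq_or_lt with h | h
          · rw [heta₀ h.symm, zero_mul]
          · rw [hj, abs_zero, Real.zero_rpow h.ne', mul_zero]
        simp only [limitPenalty, absDeriv, h0]
        simp [hj]
      · refine Finset.sum_congr rfl fun j hj => ?_
        have hj : βs j ≠ 0 := mem_active.1 hj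
        simp [limitPenalty, hj]
    · refine hreduce (fun n => √(n : ℝ)) _
        ((hg.measurable.comp hθ).comp_aemeasurable (hzm.prodMk hWm)) ?_
      filter_upwards [hae γ₁ hN] with ω hω k e bt bh hk H
      exact H.tendsto_of_free hlam₁ hω (h1.comp hk) (h2.comp hk) (hmn ω)
  · intro lam₁ eta₁ hN h1 h2 h3
    have hl : 0 ≤ lam₁ := ge_of_tendsto' h1 fun n => mul_nonneg (Real.sqrt_nonneg _) (hlam n)
    have he : 0 ≤ eta₁ := ge_of_tendsto' h3 fun n => div_nonneg (heta n) (Real.sqrt_nonneg _)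
    obtain ⟨g, hg, hgmin⟩ := exists_continuous_isArgmin hC βs (active βs)ᶜ
    let θ : Coef p × Coef p →
        Coef p × (Fin p → ℝ) × (Fin p → ℝ) × (Fin p → ℝ) × (Fin p → ℝ) := fun q =>
      (q.2, fun j => lam₁ / |q.1 j| ^ γ₁, fun j => eta₁ * |q.1 j| ^ γ₂,
        fun j => √r₀ * q.1 j, fun j => √r₀ * q.1 j)
    have hθ : Measurable θ := by fun_prop
    have hmn := fun ω => hgmin (W ω) (fun j => lam₁ / |z ω j| ^ γ₁)
      (fun j => eta₁ * |z ω j| ^ γ₂) (fun j => √r₀ * z ω j) (fun j => √r₀ * z ω j)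
      (fun j => by positivity) (fun j => by positivity)
    refine ⟨fun ω => g (θ (z ω, W ω)), Eventually.of_forall fun ω => ?_, ?_⟩
    · refine (hmn ω).congr (fun v => by simp) fun v => ?_
      congr 1
      refine Finset.sum_congr rfl fun j hj => ?_
      have hj : βs j = 0 := by simpa [active] using hj
      simp [limitPenalty, absDeriv, hj]
    · refine hreduce (fun n => √(n : ℝ)) _
        ((hg.measurable.comp hθ).comp_aemeasurable (hzm.prodMk hWm)) ?_
      filter_upwards [hae γ₁ hN] with ω hω k e bt bh hk H
      exact H.tendsto_of_active_pinned hω (h1.comp hk) (h2.comp hk) (h3.comp hk) (hmn ω)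
  · intro lam₀ eta₀ h1 h2 h3
    have hl : 0 ≤ lam₀ := ge_of_tendsto' h2 fun n => div_nonneg (hlam n) (Real.sqrt_nonneg _)
    have he : 0 ≤ eta₀ := ge_of_tendsto' h3 fun n => div_nonneg (heta n) (Real.sqrt_nonneg _)
    obtain ⟨g, hg, hgmin⟩ := exists_continuous_isArgmin hC βs (active βs)
    let θ : Coef p × Coef p →
        Coef p × (Fin p → ℝ) × (Fin p → ℝ) × (Fin p → ℝ) × (Fin p → ℝ) := fun q =>
      (q.2, fun j => lam₀ / |βs j| ^ γ₁, fun j => eta₀ * |βs j| ^ γ₂,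
        fun j => √r₀ * q.1 j, fun _ => 0)
    have hθ : Measurable θ := by fun_prop
    have hmn := fun ω => hgmin (W ω) (fun j => lam₀ / |βs j| ^ γ₁)
      (fun j => eta₀ * |βs j| ^ γ₂) (fun j => √r₀ * z ω j) (fun _ => 0)
      (fun j => by positivity) (fun j => by positivity)
    refine ⟨fun ω => g (θ (z ω, W ω)), Eventually.of_forall fun ω => ?_, ?_⟩
    · refine (hmn ω).congr (fun v => Iff.rfl) fun v => ?_
      congr 1
      refine Finset.sum_congr rfl fun j hj => ?_
      have hj : βs j ≠ 0 := mem_active.1 hj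
      simp only [limitPenalty, absDeriv, hj, if_false]
      ring
    · refine hreduce (fun n => √(n : ℝ)) _
        ((hg.measurable.comp hθ).comp_aemeasurable (hzm.prodMk hWm)) ?_
      refine Eventually.of_forall fun ω k e bt bh hk H => ?_
      exact H.tendsto_of_inactive_pinned (h1.comp hk) (h2.comp hk) (h3.comp hk) (hmn ω)
  · intro hγ h1 h2 h3
    obtain ⟨g, -, hgmin⟩ := exists_continuous_isArgmin hC βs (active βs)
    have hmn := hgmin 0 (fun j => 1 / |βs j| ^ γ₁) (fun _ => 0) (fun _ => 0) (fun _ => 0)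
      (fun j => by positivity) (fun j => le_rfl)
    refine ⟨_, hmn.congr (fun v => Iff.rfl) fun v => ?_, ?_⟩
    · simp only [WithLp.ofLp_zero, dotProduct_zero, mul_zero, sub_zero]
      congr 1
      refine Finset.sum_congr rfl fun j hj => ?_
      have hj : βs j ≠ 0 := mem_active.1 hj
      simp only [limitPenalty, absDeriv, hj, if_false]
      ring
    · refine hreduce (fun n => (n : ℝ) / lam n) _ aemeasurable_const ?_
      refine Eventually.of_forall fun ω k e bt bh hk H => ?_
      exact H.tendsto_of_lam_dominant hγ (h1.comp hk) (h2.comp hk) (h3.comp hk) hmn
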